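/- **Theorem.** Let \(S=[-\tfrac12,\tfrac12]^2\) and let \(f\) be a probability density on \(S\) with \(0<\inf_{x\in S}f(x)\le\sup_{x\in S}f(x)<\infty\). For each \(n\), let \(X_1,\dots,X_n\) be independent random points of \(S\) with density \(f\). Let \(r_n>0\), let \(G_n=G(n,r_n,f)\) be the random geometric graph on these \(n\) points in which two distinct points are adjacent if and only if their Euclidean distance is less than \(r_n\), and let \(LC_n\) be the length (the number of edges, equivalently of nodes) of the longest cycle of \(G_n\), with \(LC_n=0\) if \(G_n\) has no cycle. (i) If \(nr_n^2\to\infty\) as \(n\to\infty\), then there are constants \(\delta_1,\delta_2>0\), not depending on \(n\), such that \[ \mathbb P\left(LC_n\ge n-ne^{-\delta_1nr_n^2}\right)\ge 1-e^{-\delta_2nr_n^2} \] for all sufficiently large \(n\). (ii) Suppose that \(f\) is uniform (\(f\equiv1\) on \(S\)) and that \[ nr_n^2=\log n+7\log\log n+\omega_n , \] where \(\omega_n\to\infty\) and \(\omega_n/\log\log n\to0\) as \(n\to\infty\). Then there is a constant \(C>0\), not depending on \(n\), such that \[ \mathbb P\left(LC_n=n\right)\ge 1-Ce^{-\omega_n}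 \] for all sufficiently large \(n\); that is, \(G_n\) has a Hamiltonian cycle with at least this probability. -/

import Mathlib

open Filter Topology MeasureTheory ProbabilityTheory

/-- The Euclidean plane (with the Euclidean distance and Lebesgue measure). -/
abbrev Plane : Type := EuclideanSpace ℝ (Fin 2)

/-- The unit square `[-1/2, 1/2]²`. -/
def unitSquare : Set Plane := {x | ∀ i, x i ∈ Set.Icc (-(1 / 2) : ℝ) (1 / 2)}

/-- `f` (restricted to the unit square) is a probability density on the unit square which is
bounded away from `0` and from `∞`. -/
structure IsSquareDensity (f : Plane → ℝ) : Prop where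
  measurable : Measurable f
  integral_eq_one : ∫ x in unitSquare, f x = 1
  bounded_below : ∃ a : ℝ, 0 < a ∧ ∀ x ∈ unitSquare, a ≤ f x
  bounded_above : ∃ b : ℝ, ∀ x ∈ unitSquare, f x ≤ b

/-- The law on the plane with density `f` on the unit square and no mass outside it. -/
noncomputable def squareLaw (f : Plane → ℝ) : Measure Plane :=
  (volume.restrict unitSquare).withDensity (fun x => ENNReal.ofReal (f x))

/-- The geometric graph of the points `x 0, …, x (n - 1)` with radius `r`: two distinct indices
are adjacent iff the Euclidean distance between their points is less than `r`. -/
def geometricGraph {n : ℕ} (r : ℝ) (x : Fin n → Plane) : SimpleGraph (Fin n) where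
  Adj i j := i ≠ j ∧ dist (x i) (x j) < r
  symm := ⟨fun _ _ h => ⟨h.1.symm, by rw [dist_comm]; exact h.2⟩⟩
  loopless := ⟨fun _ h => h.1 rfl⟩

/-- The length (number of edges, equivalently of nodes) of a longest cycle of `G`, and `0` if `G`
has no cycle. On a finite vertex set the lengths of cycles are bounded, so the supremum is a
maximum whenever there is a cycle. -/
noncomputable def longestCycleLength {V : Type*} (G : SimpleGraph V) : ℕ :=
  sSup {k : ℕ | ∃ (v : V) (c : G.Walk v v), c.IsCycle ∧ c.length = k}

/-! The square is cut into `N × N` cells whose side is a constant fraction of `r`, so that points in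
the same cell, or in cells related by `NearCell`, are adjacent. With `Δ` a bound for the number of
cells near a given one, a cell with at least `Δ + 3` points is called populous. A cycle that runs
through a populous cell can be rerouted through all the points of a near cell, by opening one of its
edges inside the populous cell, and there are enough such edges to serve every near cell. Hence one
cycle contains every point whose cell is reachable through populous cells
(`card_reachable_le_longestCycleLength`); the last cell of such a path need not be populous itself.
What remains is a connectivity question about populous cells.

The probabilistic input is a Chernoff bound (`weightSum_sparse_le`): the event that no cell of a
given set `T` is populous has probability at most `q ^ T.card`, where `q` is a constant times `exp
(-c n r²)`. It is proved for finite weighted sums over assignments of points to cells, and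
`one_sub_weightSum_le` carries it over to the random points.

For (i), cells are grouped into a hierarchy of `3 × 3` blocks, a block being bad if two of its
children are. Cells with no bad block around them at any level are connected to each other
(`cellReach_of_isFineCell`). A bad block of level `j` forces `2 ^ j` sparse cells, chosen from at
most `81 ^ (2 ^ j - 1)` sets, so a given point lies in a bad block with probability at most `162 *
q`. Markov's inequality for the number of such points finishes the proof.

For (ii), windows of a constant number of cells are used. If fewer than `m` cells of each window are
sparse, then the full rows and columns of all windows are connected, and from any cell with room on
one side a walk leads to a full column. At every step it needs a populous cell among the `m` offsets
in a half disc of radius `r`. A half disc of radius 1 has area `π / 2 > 1`, so `q ^ m` beats the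
order `n` of the number of windows once `n r² ≥ log n`. A quarter disc has area less than 1, so
corners need another argument: there are boundedly many corner cells, and with high probability all
are populous (`exists_cellReach_of_fewExceptions`). Both failure probabilities are at most a
constant times a negative power of `n`, hence `O(exp (-ω))` because `ω ≤ log log n` eventually. -/

/-- The number of pairs of consecutive entries of a list which both satisfy `p`. -/
def consecutivePairs {V : Type*} (p : V → Prop) [DecidablePred p] : List V → ℕ
  | [] => 0
  | [_] => 0
  | a :: b :: l => (if p a ∧ p b then 1 else 0) + consecutivePairs p (b :: l)

/-! ### Consecutive pairs in lists -/

section ConsecutivePairs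

variable {V : Type*} (p : V → Prop) [DecidablePred p]

lemma consecutivePairs_add_le_append (l l' : List V) :
    consecutivePairs p l + consecutivePairs p l' ≤ consecutivePairs p (l ++ l') := by
  induction l with
  | nil => simp [consecutivePairs]
  | cons a l ih =>
    cases l with
    | nil => cases l' <;> simp [consecutivePairs]
    | cons b l =>
      simp only [consecutivePairs, List.cons_append] at ih ⊢
      omega

lemma consecutivePairs_append_cons_cons (l₁ l₂ : List V) (a b : V) :
    consecutivePairs p (l₁ ++ a :: b :: l₂) =
      consecutivePairs p (l₁ ++ [a]) + (if p a ∧ p b then 1 else 0) +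
        consecutivePairs p (b :: l₂) := by
  induction l₁ with
  | nil => simp [consecutivePairs]
  | cons c l ih =>
    cases l with
    | nil => simp only [List.cons_append, List.nil_append, consecutivePairs]; omega
    | cons d l =>
      simp only [consecutivePairs, List.cons_append] at ih ⊢
      omega

lemma length_le_consecutivePairs_add_one {l : List V} (h : ∀ v ∈ l, p v) :
    l.length ≤ consecutivePairs p l + 1 := by
  induction l with
  | nil => simp
  | cons a l ih =>
    cases l with
    | nil => simp
    | cons b l =>
      have := ih fun v hv => h v (List.mem_cons_of_mem _ hv)
      have h1 : p a ∧ p b := ⟨h a (by simp), h b (by simp)⟩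
      simp only [consecutivePairs, h1, List.length_cons] at this ⊢
      simp; omega

lemma exists_split_of_consecutivePairs_pos {l : List V} (h : 0 < consecutivePairs p l) :
    ∃ l₁ a b l₂, l = l₁ ++ a :: b :: l₂ ∧ p a ∧ p b := by
  induction l with
  | nil => simp [consecutivePairs] at h
  | cons a l ih =>
    cases l with
    | nil => simp [consecutivePairs] at h
    | cons b l =>
      by_cases hab : p a ∧ p b
      · exact ⟨[], a, b, l, rfl, hab.1, hab.2⟩
      · simp only [consecutivePairs, hab, if_false, zero_add] at h
        obtain ⟨l₁, x, y, l₂, hl, hx, hy⟩ := ih h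
        exact ⟨a :: l₁, x, y, l₂, by simp [hl], hx, hy⟩

end ConsecutivePairs

/-! ### Cycles as lists of vertices -/

section LongestCycle

variable {V : Type*} {G : SimpleGraph V}

/-- The new edge cannot already belong to the path: as the first edge it would force the path to
have length one, and as a later edge it would make the path return to its start. -/
lemma isCycle_cons_of_isPath {u v : V} {p : G.Walk v u} (h : G.Adj u v) (hp : p.IsPath)
    (hl : 2 ≤ p.length) : (SimpleGraph.Walk.cons h p).IsCycle := by
  rw [SimpleGraph.Walk.cons_isCycle_iff]
  refine ⟨hp, ?_⟩
  cases p with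
  | nil => simp at hl
  | @cons _ w _ h' q =>
    rw [SimpleGraph.Walk.cons_isPath_iff] at hp
    rw [SimpleGraph.Walk.edges_cons, List.mem_cons, not_or]
    constructor
    · intro he
      have hw : u = w := by
        rcases Sym2.eq_iff.1 he with ⟨h1, -⟩ | ⟨h1, -⟩
        · exact absurd h1 h.ne
        · exact h1
      subst hw
      have := SimpleGraph.Walk.length_eq_zero_iff.2 (SimpleGraph.Walk.isPath_iff_nil.1 hp.1)
      simp [this] at hl
    · intro he
      exact hp.2 (SimpleGraph.Walk.snd_mem_support_of_mem_edges _ he)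

lemma bddAbove_cycle_length [Fintype V] :
    BddAbove {k : ℕ | ∃ (v : V) (c : G.Walk v v), c.IsCycle ∧ c.length = k} := by
  refine ⟨Fintype.card V, ?_⟩
  rintro k ⟨v, c, hc, rfl⟩
  have h := hc.support_nodup.length_le_card
  simpa using h

lemma longestCycleLength_le_card [Fintype V] : longestCycleLength G ≤ Fintype.card V := by
  refine csSup_le' ?_
  rintro k ⟨v, c, hc, rfl⟩
  have h := hc.support_nodup.length_le_card
  simpa using h

/-- A list of distinct vertices, consecutive ones adjacent and the last adjacent to the first, is
a cycle. -/
lemma length_le_longestCycleLength [Fintype V] {l : List V} (hn : l.Nodup)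
    (hc : l.IsChain G.Adj) (hl : 3 ≤ l.length)
    (h : ∀ a ∈ l.head?, ∀ b ∈ l.getLast?, G.Adj b a) : l.length ≤ longestCycleLength G := by
  have hne : l ≠ [] := by rintro rfl; simp at hl
  have hadj : G.Adj (l.getLast hne) (l.head hne) :=
    h _ (by simp [List.head?_eq_some_head hne]) _ (by simp [List.getLast?_eq_some_getLast hne])
  refine le_csSup bddAbove_cycle_length
    ⟨_, SimpleGraph.Walk.cons hadj (SimpleGraph.Walk.ofSupport l hne hc), ?_, ?_⟩
  · apply isCycle_cons_of_isPath
    · rw [SimpleGraph.Walk.isPath_def, SimpleGraph.Walk.support_ofSupport]; exact hn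
    · rw [SimpleGraph.Walk.length_ofSupport]; omega
  · rw [SimpleGraph.Walk.length_cons, SimpleGraph.Walk.length_ofSupport]; omega

end LongestCycle

/-! ### A long cycle through populous cells -/

/-- `CellReach R D g c`: the cell `c` can be reached from the cell `g` by steps along `R`, all
starting in cells that satisfy `D`. -/
def CellReach {C : Type*} (R : C → C → Prop) (D : C → Prop) : C → C → Prop :=
  Relation.ReflTransGen fun u v => D u ∧ R u v

/-- A path asks for `D` at every cell except its last one, so reversing it needs `D` there as well.
-/
lemma CellReach.symm {C : Type*} {R : C → C → Prop} {D : C → Prop} (hR : ∀ u v, R u v → R v u)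
    {u v : C} (hv : D v) (h : CellReach R D u v) : CellReach R D v u := by
  induction h with
  | refl => exact .refl
  | tail _ hbc ih => exact .head ⟨hv, hR _ _ hbc.2⟩ (ih hbc.1)

/-- The number of vertices in a cell. -/
def cellCount {V C : Type*} [Fintype V] [DecidableEq C] (κ : V → C) (c : C) : ℕ :=
  (Finset.univ.filter fun v => κ v = c).card

/-- A cycle covering exactly the vertices in the cells `S`, as a list; it has enough
edges inside each populous cell to insert the neighbouring cells that are still missing. -/
structure PartialCellCycle {V C : Type*} [Fintype V] [DecidableEq C] (G : SimpleGraph V)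
    (κ : V → C) (R : C → C → Prop) [DecidableRel R] (Δ : ℕ) (g : C) (S : Finset C)
    (l : List V) : Prop where
  nodup : l.Nodup
  chain : l.IsChain G.Adj
  mem_iff : ∀ v, v ∈ l ↔ κ v ∈ S
  room : ∀ d ∈ S, Δ + 3 ≤ cellCount κ d →
    Δ + 2 ≤ consecutivePairs (fun v => κ v = d) l + (S.filter (R d)).card
  ends : ∃ a ∈ l.head?, ∃ b ∈ l.getLast?, κ a = g ∧ κ b = g ∧ b ≠ a

section CellCycle

variable {V C : Type*} [Fintype V] [DecidableEq C] {G : SimpleGraph V}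
  {κ : V → C} {R : C → C → Prop} [DecidableRel R] {Δ : ℕ} {g : C}

lemma exists_list_of_cell (hadj : ∀ u v, u ≠ v → κ u = κ v → G.Adj u v) (c : C) :
    ∃ l : List V, l.Nodup ∧ l.IsChain G.Adj ∧ (∀ v, v ∈ l ↔ κ v = c) ∧
      l.length = cellCount κ c := by
  refine ⟨(Finset.univ.filter fun v => κ v = c).toList, Finset.nodup_toList _, ?_, by simp,
    by simp [cellCount]⟩
  have h := (Finset.univ.filter fun v => κ v = c).nodup_toList
  refine List.Pairwise.isChain (List.Pairwise.imp_of_mem ?_ h)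
  intro a b ha hb hab
  simp only [Finset.mem_toList, Finset.mem_filter, Finset.mem_univ, true_and] at ha hb
  exact hadj a b hab (ha.trans hb.symm)

lemma partialCellCycle_singleton (hadj : ∀ u v, u ≠ v → κ u = κ v → G.Adj u v)
    (hg : Δ + 3 ≤ cellCount κ g) : ∃ l, PartialCellCycle G κ R Δ g {g} l := by
  obtain ⟨l, hn, hc, hm, hlen⟩ := exists_list_of_cell (G := G) hadj g
  have hne : l ≠ [] := by rintro rfl; simp at hlen; omega
  refine ⟨l, hn, hc, by simpa using hm, ?_, l.head hne, by simp [List.head?_eq_some_head hne],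
    l.getLast hne, by simp [List.getLast?_eq_some_getLast hne],
    (hm _).1 (List.head_mem _), (hm _).1 (List.getLast_mem _), ?_⟩
  · intro d hd _
    rw [Finset.mem_singleton] at hd
    subst hd
    have := length_le_consecutivePairs_add_one (fun v => κ v = d) (l := l) fun v hv => (hm v).1 hv
    omega
  · match l, hne, hn with
    | [a], _, _ => simp at hlen; omega
    | a :: b :: l, _, hn =>
      intro h
      rw [List.head_cons, List.getLast_cons (by simp)] at h
      exact (List.nodup_cons.1 hn).1 (h ▸ List.getLast_mem _)

/-- At most `Δ` cells of `S` are related to `d`, so `room` leaves a pair of consecutive vertices in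
`d`, and all of `c` is spliced in between. This costs `d` one pair but adds `c` to its covered
neighbours, so `room` persists; other cells lose no pair, and `c`, if populous, brings at least `Δ +
2` pairs of its own. Splices never touch the ends of the list, so the closing edge inside `g`
survives. -/
lemma PartialCellCycle.exists_insert {S : Finset C} {l : List V} (hR : ∀ u v, R u v → R v u)
    (hadj : ∀ u v, u ≠ v → (κ u = κ v ∨ R (κ u) (κ v)) → G.Adj u v)
    (hdeg : ∀ (c : C) (F : Finset C), (∀ d ∈ F, R c d) → F.card ≤ Δ)
    (h : PartialCellCycle G κ R Δ g S l) {c d : C} (hd : d ∈ S) (hdd : Δ + 3 ≤ cellCount κ d)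
    (hdc : R d c) (hc : c ∉ S) : ∃ l', PartialCellCycle G κ R Δ g (insert c S) l' := by
  have hroom := h.room d hd hdd
  have hdegd := hdeg d (S.filter (R d)) (by simp)
  obtain ⟨l₁, a, b, l₂, rfl, ha, hb⟩ :=
    exists_split_of_consecutivePairs_pos (fun v => κ v = d) (l := l) (by omega)
  obtain ⟨m, mn, mc, mm, mlen⟩ :=
    exists_list_of_cell (G := G) (fun u v hne huv => hadj u v hne (Or.inl huv)) c
  have hcd : c ≠ d := by rintro rfl; exact hc hd
  have hnd := h.nodup
  have hch := h.chain
  have hmem := h.mem_iff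
  have hdisj : ∀ v ∈ l₁ ++ a :: b :: l₂, v ∉ m := fun v hv hvm =>
    hc ((mm v).1 hvm ▸ (hmem v).1 hv)
  refine ⟨(l₁ ++ [a]) ++ (m ++ b :: l₂), ?_, ?_, ?_, ?_, ?_⟩
  · have e : l₁ ++ a :: b :: l₂ = (l₁ ++ [a]) ++ b :: l₂ := by simp
    rw [e] at hnd hdisj
    rw [List.nodup_append'] at hnd ⊢
    refine ⟨hnd.1, ?_, ?_⟩
    · rw [List.nodup_append']
      refine ⟨mn, hnd.2.1, ?_⟩
      intro v hvm hv
      exact hdisj v (List.mem_append_right _ hv) hvm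
    · rw [List.disjoint_append_right]
      refine ⟨?_, hnd.2.2⟩
      intro v hv hvm
      exact hdisj v (List.mem_append_left _ hv) hvm
  · rw [List.isChain_append_cons_cons] at hch
    rw [List.isChain_append]
    refine ⟨hch.1, ?_, ?_⟩
    · rw [List.isChain_append]
      refine ⟨mc, hch.2.2, ?_⟩
      intro x hx y hy
      have hxm : κ x = c := (mm x).1 (List.mem_of_mem_getLast? hx)
      simp only [List.head?_cons, Option.mem_def, Option.some.injEq] at hy
      subst hy
      refine hadj x b ?_ (Or.inr ?_)
      · rintro rfl; exact hcd (hxm.symm.trans hb)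
      · rw [hxm, hb]; exact hR _ _ hdc
    · intro x hx y hy
      simp only [List.getLast?_append, List.getLast?_singleton, Option.some_or, Option.mem_def,
        Option.some.injEq] at hx
      subst hx
      -- If the cell `c` is empty, nothing is inserted and `a`, `b` stay consecutive.
      cases m with
      | nil =>
        simp only [List.nil_append, List.head?_cons, Option.mem_def, Option.some.injEq] at hy
        subst hy
        exact hch.2.1
      | cons z m =>
        simp only [List.cons_append, List.head?_cons, Option.mem_def, Option.some.injEq] at hy
        subst hy
        have hz : κ z = c := (mm z).1 (by simp)
        refine hadj a z ?_ (Or.inr ?_)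
        · rintro rfl; exact hcd (hz.symm.trans ha)
        · rw [hz, ha]; exact hdc
  · intro v
    have := hmem v
    simp only [List.mem_append, List.mem_cons] at this
    simp only [List.mem_append, List.mem_cons, mm v, Finset.mem_insert, ← this, List.not_mem_nil]
    tauto
  · intro e he hee
    have h1 := consecutivePairs_add_le_append (fun v => κ v = e) (l₁ ++ [a]) (m ++ b :: l₂)
    have h2 := consecutivePairs_add_le_append (fun v => κ v = e) m (b :: l₂)
    have h3 := consecutivePairs_append_cons_cons (fun v => κ v = e) l₁ l₂ a b
    rw [Finset.mem_insert] at he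
    by_cases hec : e = c
    · subst hec
      have := length_le_consecutivePairs_add_one (fun v => κ v = e) (l := m)
        fun v hv => (mm v).1 hv
      omega
    · have heS : e ∈ S := he.resolve_left hec
      have h4 := h.room e heS hee
      by_cases hed : e = d
      · subst hed
        have h5 : (insert c S).filter (R e) = insert c (S.filter (R e)) := by
          rw [Finset.filter_insert, if_pos hdc]
        rw [h5, Finset.card_insert_of_notMem (by simp [hc])]
        rw [if_pos ⟨ha, hb⟩] at h3
        omega
      · have h5 : (S.filter (R e)).card ≤ ((insert c S).filter (R e)).card :=
          Finset.card_le_card (Finset.filter_subset_filter _ (Finset.subset_insert _ _))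
        rw [if_neg (fun hh => hed (hh.1.symm.trans ha))] at h3
        omega
  · obtain ⟨x, hx, y, hy, hxy⟩ := h.ends
    refine ⟨x, ?_, y, ?_, hxy⟩
    · cases l₁ <;> simpa using hx
    · rw [List.getLast?_append_of_ne_nil _ (by simp), List.getLast?_append_of_ne_nil _ (by simp)]
      rwa [List.getLast?_append_of_ne_nil _ (by simp), List.getLast?_cons_cons] at hy

/-- If the vertices are distributed over cells so that vertices in equal or `R`-related cells are
adjacent, and `g` is a populous cell, then there is a cycle through at least all the vertices
whose cells are reachable from `g` through populous cells. -/
theorem card_reachable_le_longestCycleLength [DecidableEq V] (hR : ∀ u v, R u v → R v u)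
    (hadj : ∀ u v, u ≠ v → (κ u = κ v ∨ R (κ u) (κ v)) → G.Adj u v)
    (hdeg : ∀ (c : C) (F : Finset C), (∀ d ∈ F, R c d) → F.card ≤ Δ)
    (hg : Δ + 3 ≤ cellCount κ g) (A : Finset V)
    (hA : ∀ v ∈ A, CellReach R (fun c => Δ + 3 ≤ cellCount κ c) g (κ v)) :
    A.card ≤ longestCycleLength G := by
  classical
  set I : Finset C := Finset.univ.image κ with hI
  have hmemI : ∀ c, Δ + 3 ≤ cellCount κ c → c ∈ I := by
    intro c hc
    obtain ⟨v, hv⟩ : (Finset.univ.filter fun v => κ v = c).Nonempty := by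
      rw [← Finset.card_pos]; unfold cellCount at hc; omega
    simp only [Finset.mem_filter, Finset.mem_univ, true_and] at hv
    simp only [hI, Finset.mem_image, Finset.mem_univ, true_and]
    exact ⟨v, hv⟩
  set 𝒮 : Finset (Finset C) :=
    I.powerset.filter fun S => g ∈ S ∧ ∃ l, PartialCellCycle G κ R Δ g S l with h𝒮
  have hne : 𝒮.Nonempty := by
    refine ⟨{g}, ?_⟩
    simp only [h𝒮, Finset.mem_filter, Finset.mem_powerset, Finset.singleton_subset_iff,
      Finset.mem_singleton, true_and]
    exact ⟨hmemI g hg,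
      partialCellCycle_singleton (fun u v hne huv => hadj u v hne (Or.inl huv)) hg⟩
  -- Only the finitely many occupied cells matter, so there is a largest coverable set; by the
  -- insertion lemma it is closed under steps out of populous cells.
  obtain ⟨S, hS, hmax⟩ := Finset.exists_max_image 𝒮 Finset.card hne
  simp only [h𝒮, Finset.mem_filter, Finset.mem_powerset] at hS
  obtain ⟨hSI, hgS, l, hl⟩ := hS
  have hclosed : ∀ d ∈ S, Δ + 3 ≤ cellCount κ d → ∀ c ∈ I, R d c → c ∈ S := by
    intro d hd hdd c hc hdc
    by_contra hcS
    have := hmax (insert c S) (by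
      simp only [h𝒮, Finset.mem_filter, Finset.mem_powerset]
      exact ⟨Finset.insert_subset hc hSI, Finset.mem_insert_of_mem hgS,
        hl.exists_insert hR hadj hdeg hd hdd hdc hcS⟩)
    rw [Finset.card_insert_of_notMem hcS] at this
    omega
  have hreach : ∀ c, CellReach R (fun c => Δ + 3 ≤ cellCount κ c) g c → c ∈ I → c ∈ S := by
    intro c hc
    induction hc with
    | refl => exact fun _ => hgS
    | tail _ hbc ih => exact fun hcI => hclosed _ (ih (hmemI _ hbc.1)) hbc.1 _ hcI hbc.2
  have hAl : ∀ v ∈ A, v ∈ l := fun v hv =>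
    (hl.mem_iff v).2 (hreach _ (hA v hv) (by simp [hI]))
  have hlen : ∀ B : Finset V, (∀ v ∈ B, v ∈ l) → B.card ≤ l.length := by
    intro B hB
    calc B.card ≤ l.toFinset.card := Finset.card_le_card fun v hv => by simpa using hB v hv
      _ ≤ l.length := l.toFinset_card_le
  refine (hlen A hAl).trans (length_le_longestCycleLength hl.nodup hl.chain ?_ ?_)
  · have := hlen (Finset.univ.filter fun v => κ v = g) fun v hv => by
      rw [Finset.mem_filter] at hv
      exact (hl.mem_iff v).2 (hv.2 ▸ hgS)
    unfold cellCount at hg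
    omega
  · obtain ⟨x, hx, y, hy, hxg, hyg, hxy⟩ := hl.ends
    intro a ha b hb
    cases Option.mem_unique hx ha
    cases Option.mem_unique hy hb
    exact hadj _ _ hxy (Or.inl (hyg.trans hxg.symm))

end CellCycle

/-! ### The hierarchy of blocks and its connectivity -/

/-- The `3 × 3` block to which a cell (or block) of the next finer level belongs. -/
def parentBlock (c : ℤ × ℤ) : ℤ × ℤ := (c.1 / 3, c.2 / 3)

/-- The blocks of which a block consists. -/
noncomputable def childBlocks (b : ℤ × ℤ) : Finset (ℤ × ℤ) :=
  Finset.Icc (3 * b.1) (3 * b.1 + 2) ×ˢ Finset.Icc (3 * b.2) (3 * b.2 + 2)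

/-- A cell is bad if it satisfies `S`, and a block is bad if two of its nine children are. -/
def IsBadBlock (S : ℤ × ℤ → Prop) : ℕ → ℤ × ℤ → Prop
  | 0, b => S b
  | j + 1, b => ∃ p q, p ≠ q ∧ parentBlock p = b ∧ parentBlock q = b ∧
      IsBadBlock S j p ∧ IsBadBlock S j q

lemma parentBlock_eq_iff {p b : ℤ × ℤ} : parentBlock p = b ↔
    (3 * b.1 ≤ p.1 ∧ p.1 ≤ 3 * b.1 + 2) ∧ (3 * b.2 ≤ p.2 ∧ p.2 ≤ 3 * b.2 + 2) := by
  rw [parentBlock, Prod.ext_iff]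
  simp only
  omega

lemma mem_childBlocks {p b : ℤ × ℤ} : p ∈ childBlocks b ↔ parentBlock p = b := by
  rw [parentBlock_eq_iff, childBlocks, Finset.mem_product, Finset.mem_Icc, Finset.mem_Icc]

lemma card_childBlocks (b : ℤ × ℤ) : (childBlocks b).card = 9 := by
  rw [childBlocks, Finset.card_product, Int.card_Icc, Int.card_Icc]
  have h1 : (3 * b.1 + 2 + 1 - 3 * b.1).toNat = 3 := by omega
  have h2 : (3 * b.2 + 2 + 1 - 3 * b.2).toNat = 3 := by omega
  rw [h1, h2]

lemma iterate_parentBlock (j : ℕ) (c : ℤ × ℤ) :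
    parentBlock^[j] c = (c.1 / 3 ^ j, c.2 / 3 ^ j) := by
  induction j with
  | zero => simp
  | succ j ih =>
    rw [Function.iterate_succ_apply', ih, parentBlock, pow_succ]
    simp only
    rw [Int.ediv_ediv_of_nonneg (by positivity), Int.ediv_ediv_of_nonneg (by positivity)]

section BlockConnectivity

variable {good : ℤ × ℤ → Prop} {Lk : ℤ × ℤ → ℤ × ℤ → Prop}

/-- With at most one bad child there is a row and a column of good children, which cross. Any good
child lies in a good row or a good column: otherwise its row and its column would both contain the
unique bad child, which would then be the child itself. -/
lemma link_children_of_block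
    (hadj : ∀ p q, good p → good q → (p.1 - q.1).natAbs + (p.2 - q.2).natAbs ≤ 1 → Lk p q)
    (htrans : ∀ p q s, good q → Lk p q → Lk q s → Lk p s) {b : ℤ × ℤ}
    (hb : ∀ p q, parentBlock p = b → parentBlock q = b → p ≠ q → good p ∨ good q) {p q : ℤ × ℤ}
    (hp : parentBlock p = b) (hq : parentBlock q = b) (gp : good p) (gq : good q) : Lk p q := by
  obtain ⟨b₁, b₂⟩ := b
  have hrow : ∀ y, (∀ x, 3 * b₁ ≤ x → x ≤ 3 * b₁ + 2 → good (x, y)) → ∀ x x',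
      3 * b₁ ≤ x → x ≤ 3 * b₁ + 2 → 3 * b₁ ≤ x' → x' ≤ 3 * b₁ + 2 → Lk (x, y) (x', y) := by
    intro y hy x x' h1 h2 h3 h4
    have hm := hy (3 * b₁ + 1) (by omega) (by omega)
    exact htrans _ (3 * b₁ + 1, y) _ hm
      (hadj _ _ (hy x h1 h2) hm (by simp only; omega))
      (hadj _ _ hm (hy x' h3 h4) (by simp only; omega))
  have hcol : ∀ x, (∀ y, 3 * b₂ ≤ y → y ≤ 3 * b₂ + 2 → good (x, y)) → ∀ y y',
      3 * b₂ ≤ y → y ≤ 3 * b₂ + 2 → 3 * b₂ ≤ y' → y' ≤ 3 * b₂ + 2 → Lk (x, y) (x, y') := by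
    intro x hx y y' h1 h2 h3 h4
    have hm := hx (3 * b₂ + 1) (by omega) (by omega)
    exact htrans _ (x, 3 * b₂ + 1) _ hm
      (hadj _ _ (hx y h1 h2) hm (by simp only; omega))
      (hadj _ _ hm (hx y' h3 h4) (by simp only; omega))
  have hpar : ∀ x y, 3 * b₁ ≤ x → x ≤ 3 * b₁ + 2 → 3 * b₂ ≤ y → y ≤ 3 * b₂ + 2 →
      parentBlock (x, y) = (b₁, b₂) := fun x y h1 h2 h3 h4 =>
    parentBlock_eq_iff.2 ⟨⟨h1, h2⟩, h3, h4⟩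
  have htwo : ∀ x y x' y', 3 * b₁ ≤ x → x ≤ 3 * b₁ + 2 → 3 * b₂ ≤ y → y ≤ 3 * b₂ + 2 →
      3 * b₁ ≤ x' → x' ≤ 3 * b₁ + 2 → 3 * b₂ ≤ y' → y' ≤ 3 * b₂ + 2 →
      ¬ good (x, y) → ¬ good (x', y') → x = x' ∧ y = y' := by
    intro x y x' y' h1 h2 h3 h4 h5 h6 h7 h8 g g'
    by_contra hne
    have := hb (x, y) (x', y') (hpar x y h1 h2 h3 h4) (hpar x' y' h5 h6 h7 h8)
      (fun h => hne (by simpa using h))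
    tauto
  obtain ⟨x₀, hx1, hx2, hx⟩ : ∃ x₀, 3 * b₁ ≤ x₀ ∧ x₀ ≤ 3 * b₁ + 2 ∧
      ∀ y, 3 * b₂ ≤ y → y ≤ 3 * b₂ + 2 → good (x₀, y) := by
    by_contra! hcon
    obtain ⟨y, hy1, hy2, hy⟩ := hcon (3 * b₁) (by omega) (by omega)
    obtain ⟨y', hy1', hy2', hy'⟩ := hcon (3 * b₁ + 1) (by omega) (by omega)
    have := htwo _ _ _ _ (by omega) (by omega) hy1 hy2 (by omega) (by omega) hy1' hy2' hy hy'
    omega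
  obtain ⟨y₀, hy1, hy2, hy⟩ : ∃ y₀, 3 * b₂ ≤ y₀ ∧ y₀ ≤ 3 * b₂ + 2 ∧
      ∀ x, 3 * b₁ ≤ x → x ≤ 3 * b₁ + 2 → good (x, y₀) := by
    by_contra! hcon
    obtain ⟨y, hy1, hy2, hy⟩ := hcon (3 * b₂) (by omega) (by omega)
    obtain ⟨y', hy1', hy2', hy'⟩ := hcon (3 * b₂ + 1) (by omega) (by omega)
    have := htwo _ _ _ _ hy1 hy2 (by omega) (by omega) hy1' hy2' (by omega) (by omega) hy hy'
    omega
  have key : ∀ x y, parentBlock (x, y) = (b₁, b₂) → good (x, y) →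
      Lk (x, y) (x₀, y₀) ∧ Lk (x₀, y₀) (x, y) := by
    intro x y hxy g
    obtain ⟨⟨h1, h2⟩, h3, h4⟩ := parentBlock_eq_iff.1 hxy
    simp only at h1 h2 h3 h4
    by_cases hr : ∀ x', 3 * b₁ ≤ x' → x' ≤ 3 * b₁ + 2 → good (x', y)
    · exact ⟨htrans _ _ _ (hx y h3 h4) (hrow y hr x x₀ h1 h2 hx1 hx2)
          (hcol x₀ hx y y₀ h3 h4 hy1 hy2),
        htrans _ _ _ (hx y h3 h4) (hcol x₀ hx y₀ y hy1 hy2 h3 h4)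
          (hrow y hr x₀ x hx1 hx2 h1 h2)⟩
    · by_cases hc : ∀ y', 3 * b₂ ≤ y' → y' ≤ 3 * b₂ + 2 → good (x, y')
      · exact ⟨htrans _ _ _ (hy x h1 h2) (hcol x hc y y₀ h3 h4 hy1 hy2)
            (hrow y₀ hy x x₀ h1 h2 hx1 hx2),
          htrans _ _ _ (hy x h1 h2) (hrow y₀ hy x₀ x hx1 hx2 h1 h2)
            (hcol x hc y₀ y hy1 hy2 h3 h4)⟩
      · push Not at hr hc
        obtain ⟨x', hx1', hx2', hx'⟩ := hr
        obtain ⟨y', hy1', hy2', hy'⟩ := hc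
        obtain ⟨rfl, rfl⟩ := htwo _ _ _ _ hx1' hx2' h3 h4 h1 h2 hy1' hy2' hx' hy'
        exact absurd g hx'
  exact htrans _ _ _ (hx y₀ hy1 hy2) (key p.1 p.2 hp gp).1 (key q.1 q.2 hq gq).2

/-- Three disjoint pairs of children face each other across the common side, and the at most two bad
children spoil at most two of them. -/
lemma exists_adjacent_good_children {b b' : ℤ × ℤ}
    (hbb : (b.1 - b'.1).natAbs + (b.2 - b'.2).natAbs = 1)
    (hb : ∀ p q, parentBlock p = b → parentBlock q = b → p ≠ q → good p ∨ good q)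
    (hb' : ∀ p q, parentBlock p = b' → parentBlock q = b' → p ≠ q → good p ∨ good q) :
    ∃ p q, parentBlock p = b ∧ parentBlock q = b' ∧ good p ∧ good q ∧
      (p.1 - q.1).natAbs + (p.2 - q.2).natAbs ≤ 1 := by
  have main : ∀ p q : ℤ → ℤ × ℤ, (∀ i, 0 ≤ i → i ≤ 2 → parentBlock (p i) = b) →
      (∀ i, 0 ≤ i → i ≤ 2 → parentBlock (q i) = b') → Function.Injective p →
      Function.Injective q → (∀ i, ((p i).1 - (q i).1).natAbs + ((p i).2 - (q i).2).natAbs ≤ 1) →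
      ∃ p q, parentBlock p = b ∧ parentBlock q = b' ∧ good p ∧ good q ∧
        (p.1 - q.1).natAbs + (p.2 - q.2).natAbs ≤ 1 := by
    intro p q hp hq ip iq hpq
    by_contra! hcon
    have h : ∀ i, 0 ≤ i → i ≤ 2 → good (p i) → ¬ good (q i) := fun i h1 h2 gp gq =>
      absurd (hpq i) (not_le.2 (hcon _ _ (hp i h1 h2) (hq i h1 h2) gp gq))
    have e : ∀ i j, 0 ≤ i → i ≤ 2 → 0 ≤ j → j ≤ 2 → i ≠ j → good (p i) ∨ good (p j) :=
      fun i j h1 h2 h3 h4 h5 => hb _ _ (hp i h1 h2) (hp j h3 h4) fun h => h5 (ip h)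
    have e' : ∀ i j, 0 ≤ i → i ≤ 2 → 0 ≤ j → j ≤ 2 → i ≠ j → good (q i) ∨ good (q j) :=
      fun i j h1 h2 h3 h4 h5 => hb' _ _ (hq i h1 h2) (hq j h3 h4) fun h => h5 (iq h)
    have h0 := h 0 (by norm_num) (by norm_num)
    have h1 := h 1 (by norm_num) (by norm_num)
    have h2 := h 2 (by norm_num) (by norm_num)
    have e01 := e 0 1 (by norm_num) (by norm_num) (by norm_num) (by norm_num) (by norm_num)
    have e02 := e 0 2 (by norm_num) (by norm_num) (by norm_num) (by norm_num) (by norm_num)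
    have e12 := e 1 2 (by norm_num) (by norm_num) (by norm_num) (by norm_num) (by norm_num)
    have f01 := e' 0 1 (by norm_num) (by norm_num) (by norm_num) (by norm_num) (by norm_num)
    have f02 := e' 0 2 (by norm_num) (by norm_num) (by norm_num) (by norm_num) (by norm_num)
    have f12 := e' 1 2 (by norm_num) (by norm_num) (by norm_num) (by norm_num) (by norm_num)
    tauto
  obtain ⟨b₁, b₂⟩ := b
  obtain ⟨b₁', b₂'⟩ := b'
  simp only at hbb
  have hcases : (b₁' = b₁ + 1 ∧ b₂' = b₂) ∨ (b₁' = b₁ - 1 ∧ b₂' = b₂) ∨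
      (b₁' = b₁ ∧ b₂' = b₂ + 1) ∨ (b₁' = b₁ ∧ b₂' = b₂ - 1) := by omega
  rcases hcases with ⟨rfl, rfl⟩ | ⟨rfl, rfl⟩ | ⟨rfl, rfl⟩ | ⟨rfl, rfl⟩
  · refine main (fun i => (3 * b₁ + 2, 3 * b₂' + i)) (fun i => (3 * b₁ + 3, 3 * b₂' + i)) ?_ ?_
      (fun i j h => by simpa using h) (fun i j h => by simpa using h) ?_
    all_goals intros; simp only [parentBlock_eq_iff]; omega
  · refine main (fun i => (3 * b₁, 3 * b₂' + i)) (fun i => (3 * b₁ - 1, 3 * b₂' + i)) ?_ ?_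
      (fun i j h => by simpa using h) (fun i j h => by simpa using h) ?_
    all_goals intros; simp only [parentBlock_eq_iff]; omega
  · refine main (fun i => (3 * b₁' + i, 3 * b₂ + 2)) (fun i => (3 * b₁' + i, 3 * b₂ + 3)) ?_ ?_
      (fun i j h => by simpa using h) (fun i j h => by simpa using h) ?_
    all_goals intros; simp only [parentBlock_eq_iff]; omega
  · refine main (fun i => (3 * b₁' + i, 3 * b₂)) (fun i => (3 * b₁' + i, 3 * b₂ - 1)) ?_ ?_
      (fun i j h => by simpa using h) (fun i j h => by simpa using h) ?_
    all_goals intros; simp only [parentBlock_eq_iff]; omega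

end BlockConnectivity

/-- None of the blocks of levels `0, …, k` around a cell is bad. -/
def IsFineCell (S : ℤ × ℤ → Prop) (k : ℕ) (c : ℤ × ℤ) : Prop :=
  ∀ j ≤ k, ¬ IsBadBlock S j (parentBlock^[j] c)

lemma IsFineCell.mono {S : ℤ × ℤ → Prop} {j k : ℕ} (hjk : j ≤ k) {c : ℤ × ℤ}
    (h : IsFineCell S k c) : IsFineCell S j c := fun i hi => h i (hi.trans hjk)

/-- Among any two children of a good block one is good, so one can descend through good blocks. This
supplies the intermediate cells when connections are composed. -/
lemma exists_isFineCell_of_not_isBadBlock {S : ℤ × ℤ → Prop} (j : ℕ) (b : ℤ × ℤ)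
    (hb : ¬ IsBadBlock S j b) : ∃ c, parentBlock^[j] c = b ∧ IsFineCell S j c := by
  induction j generalizing b with
  | zero =>
    refine ⟨b, rfl, ?_⟩
    intro i hi
    obtain rfl : i = 0 := by omega
    exact hb
  | succ j ih =>
    obtain ⟨p, hpb, hp⟩ : ∃ p, parentBlock p = b ∧ ¬ IsBadBlock S j p := by
      by_contra! hcon
      refine hb ⟨(3 * b.1, 3 * b.2), (3 * b.1 + 1, 3 * b.2), by simp, ?_, ?_, hcon _ ?_, hcon _ ?_⟩
      all_goals simp only [parentBlock_eq_iff]; omega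
    obtain ⟨c, hc, hf⟩ := ih p hp
    have hc' : parentBlock^[j + 1] c = b := by rw [Function.iterate_succ_apply', hc, hpb]
    refine ⟨c, hc', ?_⟩
    intro i hi
    rcases Nat.lt_or_ge i (j + 1) with h | h
    · exact hf i (by omega)
    · obtain rfl : i = j + 1 := by omega
      rw [hc']; exact hb

lemma cellReach_of_isFineCell_aux {S : ℤ × ℤ → Prop} {R : ℤ × ℤ → ℤ × ℤ → Prop}
    (hR : ∀ u v : ℤ × ℤ, (u.1 - v.1).natAbs + (u.2 - v.2).natAbs ≤ 1 → R u v) (j : ℕ) :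
    ∀ b b' : ℤ × ℤ, (b.1 - b'.1).natAbs + (b.2 - b'.2).natAbs ≤ 1 → ∀ c c' : ℤ × ℤ,
      parentBlock^[j] c = b →
      parentBlock^[j] c' = b' → IsFineCell S j c → IsFineCell S j c' →
      CellReach R (fun u => ¬ S u) c c' := by
  induction j with
  | zero =>
    intro b b' hbb c c' hc hc' hf hf'
    simp only [Function.iterate_zero, id_eq] at hc hc'
    subst hc hc'
    exact .single ⟨hf 0 le_rfl, hR _ _ hbb⟩
  | succ j ih =>
    intro b b' hbb c c' hc hc' hf hf'
    set good : ℤ × ℤ → Prop := fun p => ¬ IsBadBlock S j p with hgood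
    set Lk : ℤ × ℤ → ℤ × ℤ → Prop := fun p q => ∀ c c', parentBlock^[j] c = p →
      parentBlock^[j] c' = q → IsFineCell S j c → IsFineCell S j c' →
      CellReach R (fun u => ¬ S u) c c' with hLk
    have hadj : ∀ p q, good p → good q → (p.1 - q.1).natAbs + (p.2 - q.2).natAbs ≤ 1 → Lk p q :=
      fun p q _ _ hpq => ih p q hpq
    -- `Lk p q` speaks of all fine cells in `p` and `q` and would be vacuous for a `q` without any;
    -- goodness of `q` provides a fine cell at which to join the two paths.
    have htrans : ∀ p q s, good q → Lk p q → Lk q s → Lk p s := by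
      intro p q s hq h1 h2 c c' hc hc' hf hf'
      obtain ⟨m, hm, hmf⟩ := exists_isFineCell_of_not_isBadBlock j q hq
      exact (h1 c m hc hm hf hmf).trans (h2 m c' hm hc' hmf hf')
    have hfew : ∀ b, ¬ IsBadBlock S (j + 1) b → ∀ p q, parentBlock p = b → parentBlock q = b →
        p ≠ q → good p ∨ good q := by
      intro b hb p q hp hq hpq
      by_contra! hcon
      exact hb ⟨p, q, hpq, hp, hq, not_not.1 hcon.1, not_not.1 hcon.2⟩
    have hb : ¬ IsBadBlock S (j + 1) b := hc ▸ hf (j + 1) le_rfl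
    have hb' : ¬ IsBadBlock S (j + 1) b' := hc' ▸ hf' (j + 1) le_rfl
    rw [Function.iterate_succ_apply'] at hc hc'
    have gc : good (parentBlock^[j] c) := hf j (by omega)
    have gc' : good (parentBlock^[j] c') := hf' j (by omega)
    suffices h : Lk (parentBlock^[j] c) (parentBlock^[j] c') from
      h c c' rfl rfl (hf.mono (by omega)) (hf'.mono (by omega))
    by_cases hbe : b = b'
    · subst hbe
      exact link_children_of_block hadj htrans (hfew b hb) hc hc' gc gc'
    · have hbb1 : (b.1 - b'.1).natAbs + (b.2 - b'.2).natAbs = 1 := by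
        rw [Prod.ext_iff] at hbe
        omega
      obtain ⟨p, q, hp, hq, gp, gq, hpq⟩ :=
        exists_adjacent_good_children hbb1 (hfew b hb) (hfew b' hb')
      exact htrans _ _ _ gq (htrans _ _ _ gp
        (link_children_of_block hadj htrans (hfew b hb) hc hp gc gp) (hadj _ _ gp gq hpq))
        (link_children_of_block hadj htrans (hfew b' hb') hq hc' gq gc')

/-- All fine cells in a common block of level `k` are connected. -/
lemma cellReach_of_isFineCell {S : ℤ × ℤ → Prop} {R : ℤ × ℤ → ℤ × ℤ → Prop}
    (hR : ∀ u v : ℤ × ℤ, (u.1 - v.1).natAbs + (u.2 - v.2).natAbs ≤ 1 → R u v) {k : ℕ}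
    {c c' : ℤ × ℤ}
    (h : parentBlock^[k] c = parentBlock^[k] c') (hc : IsFineCell S k c)
    (hc' : IsFineCell S k c') : CellReach R (fun u => ¬ S u) c c' :=
  cellReach_of_isFineCell_aux hR k _ _ (by simp [h]) c c' rfl rfl hc hc'

/-- A bad block of level `j` contains `2 ^ j` cells that satisfy `S`, and there are not many
candidates for this set of cells. -/
lemma exists_family_of_isBadBlock (j : ℕ) (b : ℤ × ℤ) : ∃ F : Finset (Finset (ℤ × ℤ)),
    F.card ≤ 81 ^ (2 ^ j - 1) ∧
    (∀ T ∈ F, T.card = 2 ^ j ∧ ∀ u ∈ T, parentBlock^[j] u = b) ∧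
    ∀ S, IsBadBlock S j b → ∃ T ∈ F, ∀ u ∈ T, S u := by
  induction j generalizing b with
  | zero =>
    refine ⟨{{b}}, by simp, ?_, ?_⟩
    · intro T hT
      rw [Finset.mem_singleton] at hT
      subst hT
      simp
    · intro S hS
      exact ⟨{b}, by simp, by simpa [IsBadBlock] using hS⟩
  | succ j ih =>
    choose F hF1 hF2 hF3 using ih
    refine ⟨((childBlocks b ×ˢ childBlocks b).filter fun pq => pq.1 ≠ pq.2).biUnion fun pq =>
      Finset.image₂ (· ∪ ·) (F pq.1) (F pq.2), ?_, ?_, ?_⟩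
    · refine Finset.card_biUnion_le.trans ?_
      calc _ ≤ ∑ _pq ∈ (childBlocks b ×ˢ childBlocks b).filter fun pq => pq.1 ≠ pq.2,
              81 ^ (2 ^ j - 1) * 81 ^ (2 ^ j - 1) := by
            refine Finset.sum_le_sum fun pq _ => (Finset.card_image₂_le _ _ _).trans ?_
            exact Nat.mul_le_mul (hF1 _) (hF1 _)
        -- There are at most `9 * 9` pairs of children, so the number of candidates at most squares
        -- and gains a factor 81 with each level.
        _ ≤ 81 * (81 ^ (2 ^ j - 1) * 81 ^ (2 ^ j - 1)) := by
            rw [Finset.sum_const, smul_eq_mul]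
            refine Nat.mul_le_mul_right _ ((Finset.card_filter_le _ _).trans ?_)
            rw [Finset.card_product, card_childBlocks]
        _ = 81 ^ (2 ^ (j + 1) - 1) := by
            rw [← pow_add, ← pow_succ']
            congr 1
            have : 1 ≤ 2 ^ j := Nat.one_le_two_pow
            rw [pow_succ]; omega
    · intro T hT
      simp only [Finset.mem_biUnion, Finset.mem_filter, Finset.mem_product, mem_childBlocks,
        Finset.mem_image₂] at hT
      obtain ⟨⟨p, q⟩, ⟨⟨hp, hq⟩, hpq⟩, A, hA, B, hB, rfl⟩ := hT
      obtain ⟨hA1, hA2⟩ := hF2 p A hA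
      obtain ⟨hB1, hB2⟩ := hF2 q B hB
      constructor
      · rw [Finset.card_union_of_disjoint, hA1, hB1, pow_succ]
        · omega
        · rw [Finset.disjoint_left]
          intro u hu hu'
          exact hpq ((hA2 u hu).symm.trans (hB2 u hu'))
      · intro u hu
        rw [Function.iterate_succ_apply']
        rcases Finset.mem_union.1 hu with hu | hu
        · rw [hA2 u hu, hp]
        · rw [hB2 u hu, hq]
    · rintro S ⟨p, q, hpq, hp, hq, hSp, hSq⟩
      obtain ⟨A, hA, hAS⟩ := hF3 p S hSp
      obtain ⟨B, hB, hBS⟩ := hF3 q S hSq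
      refine ⟨A ∪ B, ?_, ?_⟩
      · simp only [Finset.mem_biUnion, Finset.mem_filter, Finset.mem_product, mem_childBlocks,
          Finset.mem_image₂]
        exact ⟨(p, q), ⟨⟨hp, hq⟩, hpq⟩, A, hA, B, hB, rfl⟩
      · intro u hu
        rcases Finset.mem_union.1 hu with hu | hu
        · exact hAS u hu
        · exact hBS u hu

/-! ### Near cells, and connectivity through windows -/

/-- Any two points of the cells `u` and `v` of a grid are less than `M` cell sides apart. -/
def NearCell (M : ℤ) (u v : ℤ × ℤ) : Prop :=
  (|u.1 - v.1| + 1) ^ 2 + (|u.2 - v.2| + 1) ^ 2 < M ^ 2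

instance (M : ℤ) : DecidableRel (NearCell M) := fun _ _ => inferInstanceAs (Decidable (_ < _))

lemma NearCell.symm {M : ℤ} {u v : ℤ × ℤ} (h : NearCell M u v) : NearCell M v u := by
  unfold NearCell at h ⊢
  rwa [abs_sub_comm v.1, abs_sub_comm v.2]

lemma NearCell.of_le {M : ℤ} {u v u' v' : ℤ × ℤ} (h : NearCell M u v)
    (h1 : |u'.1 - v'.1| ≤ |u.1 - v.1|) (h2 : |u'.2 - v'.2| ≤ |u.2 - v.2|) :
    NearCell M u' v' := by
  unfold NearCell at h ⊢
  refine lt_of_le_of_lt ?_ h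
  gcongr

lemma NearCell.abs_lt {M : ℤ} (hM : 0 ≤ M) {u v : ℤ × ℤ} (h : NearCell M u v) :
    |u.1 - v.1| + 1 < M ∧ |u.2 - v.2| + 1 < M := by
  unfold NearCell at h
  constructor
  · exact lt_of_pow_lt_pow_left₀ 2 hM (lt_of_le_of_lt (le_add_of_nonneg_right (sq_nonneg _)) h)
  · exact lt_of_pow_lt_pow_left₀ 2 hM (lt_of_le_of_lt (le_add_of_nonneg_left (sq_nonneg _)) h)

lemma nearCell_of_natAbs_le {M : ℤ} (hM : 3 ≤ M) {u v : ℤ × ℤ}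
    (h : (u.1 - v.1).natAbs + (u.2 - v.2).natAbs ≤ 1) : NearCell M u v := by
  have h' : |u.1 - v.1| + |u.2 - v.2| ≤ 1 := by
    rw [Int.abs_eq_natAbs, Int.abs_eq_natAbs]; exact_mod_cast h
  unfold NearCell
  have h1 := abs_nonneg (u.1 - v.1)
  have h2 := abs_nonneg (u.2 - v.2)
  nlinarith

lemma card_le_of_nearCell {M : ℤ} (hM : 0 ≤ M) (c : ℤ × ℤ) (F : Finset (ℤ × ℤ))
    (hF : ∀ d ∈ F, NearCell M c d) : F.card ≤ ((2 * M + 1) ^ 2).toNat := by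
  have hsub : F ⊆ Finset.Icc (c.1 - M) (c.1 + M) ×ˢ Finset.Icc (c.2 - M) (c.2 + M) := by
    intro d hd
    obtain ⟨h1, h2⟩ := (hF d hd).abs_lt hM
    rw [Finset.mem_product, Finset.mem_Icc, Finset.mem_Icc]
    have h3 := abs_le.1 (show |c.1 - d.1| ≤ M by omega)
    have h4 := abs_le.1 (show |c.2 - d.2| ≤ M by omega)
    omega
  refine (Finset.card_le_card hsub).trans ?_
  rw [Finset.card_product, Int.card_Icc, Int.card_Icc]
  have h1 : (c.1 + M + 1 - (c.1 - M)).toNat = (2 * M + 1).toNat := by congr 1; ring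
  have h2 : (c.2 + M + 1 - (c.2 - M)).toNat = (2 * M + 1).toNat := by congr 1; ring
  rw [h1, h2, sq, Int.toNat_mul (by omega) (by omega)]

/-- The cell `u` lies in the `L × L` window whose corner with the least coordinates is `o`. -/
def InWindow (L : ℤ) (o u : ℤ × ℤ) : Prop :=
  o.1 ≤ u.1 ∧ u.1 < o.1 + L ∧ o.2 ≤ u.2 ∧ u.2 < o.2 + L

/-- Fewer than `m` cells of the window fail to satisfy `D`. -/
def FewExceptions (D : ℤ × ℤ → Prop) (L : ℤ) (m : ℕ) (o : ℤ × ℤ) : Prop :=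
  ∀ T : Finset (ℤ × ℤ), (∀ u ∈ T, InWindow L o u ∧ ¬ D u) → T.card < m

/-- The column through `u` or the row through `u` satisfies `D` inside the window. -/
def InCore (D : ℤ × ℤ → Prop) (L : ℤ) (o u : ℤ × ℤ) : Prop :=
  InWindow L o u ∧ ((∀ y, o.2 ≤ y → y < o.2 + L → D (u.1, y)) ∨
    (∀ x, o.1 ≤ x → x < o.1 + L → D (x, u.2)))

lemma FewExceptions.comp {D : ℤ × ℤ → Prop} {L : ℤ} {m : ℕ} {o o' : ℤ × ℤ} {σ : ℤ × ℤ → ℤ × ℤ}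
    (hσ : Function.Injective σ) (hw : ∀ u, InWindow L o' u → InWindow L o (σ u))
    (h : FewExceptions D L m o) : FewExceptions (D ∘ σ) L m o' := by
  intro T hT
  rw [← Finset.card_image_of_injective T hσ]
  refine h _ ?_
  intro u hu
  obtain ⟨v, hv, rfl⟩ := Finset.mem_image.1 hu
  exact ⟨hw v (hT v hv).1, (hT v hv).2⟩

lemma CellReach.map {C : Type*} {R : C → C → Prop} {D : C → Prop} {σ : C → C}
    (hσ : ∀ u v, R u v → R (σ u) (σ v)) {u v : C} (h : CellReach R (D ∘ σ) u v) :
    CellReach R D (σ u) (σ v) := by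
  induction h with
  | refl => exact .refl
  | tail _ hbc ih => exact ih.tail ⟨hbc.1, hσ _ _ hbc.2⟩

section Windows

variable {D : ℤ × ℤ → Prop} {L M : ℤ} {m : ℕ}

/-- Otherwise each of the `m` columns would contribute an exception of its own. -/
lemma FewExceptions.exists_column {o : ℤ × ℤ} (h : FewExceptions D L m o) {X : Finset ℤ}
    (hX : ∀ x ∈ X, o.1 ≤ x ∧ x < o.1 + L) (hm : m ≤ X.card) :
    ∃ x ∈ X, ∀ y, o.2 ≤ y → y < o.2 + L → D (x, y) := by
  by_contra! hcon
  choose! f hf1 hf2 hf3 using hcon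
  have hinj : Function.Injective fun x : ℤ => (x, f x) := fun x x' hx => (Prod.ext_iff.1 hx).1
  have := h (X.image fun x => (x, f x)) (by
    intro u hu
    obtain ⟨x, hx, rfl⟩ := Finset.mem_image.1 hu
    exact ⟨⟨(hX x hx).1, (hX x hx).2, hf1 x hx, hf2 x hx⟩, hf3 x hx⟩)
  rw [Finset.card_image_of_injective _ hinj] at this
  omega

lemma FewExceptions.swap {o : ℤ × ℤ} (h : FewExceptions D L m o) :
    FewExceptions (D ∘ Prod.swap) L m o.swap :=
  h.comp Prod.swap_injective fun _ hu => ⟨hu.2.2.1, hu.2.2.2, hu.1, hu.2.1⟩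

lemma FewExceptions.exists_row {o : ℤ × ℤ} (h : FewExceptions D L m o) {Y : Finset ℤ}
    (hY : ∀ y ∈ Y, o.2 ≤ y ∧ y < o.2 + L) (hm : m ≤ Y.card) :
    ∃ y ∈ Y, ∀ x, o.1 ≤ x → x < o.1 + L → D (x, y) :=
  h.swap.exists_column hY hm

lemma InCore.swap {o u : ℤ × ℤ} (h : InCore (D ∘ Prod.swap) L o u) :
    InCore D L o.swap u.swap :=
  ⟨⟨h.1.2.2.1, h.1.2.2.2, h.1.1, h.1.2.1⟩, h.2.symm⟩

lemma cellReach_column (hM : 3 ≤ M) {x a b : ℤ} (h : ∀ y, a ≤ y → y < b → D (x, y)) {y y' : ℤ}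
    (hy : a ≤ y) (hyb : y < b) (hy' : a ≤ y') (hyb' : y' < b) :
    CellReach (NearCell M) D (x, y) (x, y') := by
  have main : ∀ y, a ≤ y → ∀ y', y ≤ y' → y' < b → CellReach (NearCell M) D (x, y) (x, y') := by
    intro y hy y' hyy'
    induction y', hyy' using Int.leInduction with
    | base => exact fun _ => .refl
    | succ z hz ih =>
      intro hzb
      refine (ih (by omega)).tail ⟨h z (by omega) (by omega), nearCell_of_natAbs_le hM ?_⟩
      simp only
      omega
  rcases le_total y y' with hle | hle
  · exact main y hy y' hle hyb'
  · exact (main y' hy' y hle hyb).symm (fun _ _ => NearCell.symm) (h y hy hyb)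

lemma NearCell.swap {u v : ℤ × ℤ} (h : NearCell M u v) : NearCell M u.swap v.swap := by
  unfold NearCell at h ⊢
  simp only [Prod.fst_swap, Prod.snd_swap]
  omega

lemma cellReach_swap {u v : ℤ × ℤ} (h : CellReach (NearCell M) (D ∘ Prod.swap) u v) :
    CellReach (NearCell M) D u.swap v.swap :=
  CellReach.map (R := NearCell M) (σ := Prod.swap) (fun _ _ h => h.swap) h

lemma cellReach_row (hM : 3 ≤ M) {y a b : ℤ} (h : ∀ x, a ≤ x → x < b → D (x, y)) {x x' : ℤ}
    (hx : a ≤ x) (hxb : x < b) (hx' : a ≤ x') (hxb' : x' < b) :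
    CellReach (NearCell M) D (x, y) (x', y) :=
  cellReach_swap (cellReach_column (D := D ∘ Prod.swap) hM h hx hxb hx' hxb')

lemma InCore.dense {o u : ℤ × ℤ} (h : InCore D L o u) : D u := by
  obtain ⟨⟨h1, h2, h3, h4⟩, h | h⟩ := h
  · exact h u.2 h3 h4
  · exact h u.1 h1 h2

/-- A full column and a full row of the window cross each other, and every full line meets one of
them. -/
lemma FewExceptions.cellReach_core (hM : 3 ≤ M) (hL : (m : ℤ) ≤ L) {o u v : ℤ × ℤ}
    (h : FewExceptions D L m o) (hu : InCore D L o u) (hv : InCore D L o v) :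
    CellReach (NearCell M) D u v := by
  obtain ⟨x, hx, hcol⟩ := h.exists_column (X := Finset.Ico o.1 (o.1 + L))
    (fun x hx => Finset.mem_Ico.1 hx) (by rw [Int.card_Ico]; omega)
  obtain ⟨y, hy, hrow⟩ := h.exists_row (Y := Finset.Ico o.2 (o.2 + L))
    (fun x hx => Finset.mem_Ico.1 hx) (by rw [Int.card_Ico]; omega)
  rw [Finset.mem_Ico] at hx hy
  have key : ∀ w, InCore D L o w → CellReach (NearCell M) D w (x, y) := by
    rintro ⟨a, b⟩ ⟨⟨h1, h2, h3, h4⟩, hw | hw⟩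
    · exact (cellReach_column hM hw h3 h4 hy.1 hy.2).trans
        (cellReach_row hM hrow h1 h2 hx.1 hx.2)
    · exact (cellReach_row hM hw h1 h2 hx.1 hx.2).trans
        (cellReach_column hM hcol h3 h4 hy.1 hy.2)
  exact (key u hu).trans ((key v hv).symm (fun _ _ => NearCell.symm)
    (hcol y hy.1 hy.2))

/-- A window and its shift by one share `L - 1 ≥ m` columns, and one of these is full. Cores of
neighbouring windows can thus be chained across the grid. -/
lemma FewExceptions.exists_common_core_right (hL : (m : ℤ) < L) {o : ℤ × ℤ}
    (h : FewExceptions D L m o) : ∃ u, InCore D L o u ∧ InCore D L (o.1 + 1, o.2) u := by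
  obtain ⟨x, hx, hcol⟩ := h.exists_column (X := Finset.Ico (o.1 + 1) (o.1 + L))
    (fun x hx => by rw [Finset.mem_Ico] at hx; omega) (by rw [Int.card_Ico]; omega)
  rw [Finset.mem_Ico] at hx
  exact ⟨(x, o.2), ⟨⟨by simp only; omega, hx.2, le_rfl, by simp only; omega⟩, Or.inl hcol⟩,
    ⟨hx.1, by simp only; omega, le_rfl, by simp only; omega⟩, Or.inl hcol⟩

lemma FewExceptions.exists_common_core_up (hL : (m : ℤ) < L) {o : ℤ × ℤ}
    (h : FewExceptions D L m o) : ∃ u, InCore D L o u ∧ InCore D L (o.1, o.2 + 1) u := by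
  obtain ⟨u, hu, hu'⟩ := h.swap.exists_common_core_right hL
  exact ⟨u.swap, hu.swap, hu'.swap⟩

/-- If all windows have few exceptions, then all their cores are connected to each other. -/
lemma exists_cellReach_core {N : ℤ} (hM : 3 ≤ M) (hL : (m : ℤ) < L) (hN : L ≤ N)
    (h : ∀ o : ℤ × ℤ, 0 ≤ o.1 → o.1 + L ≤ N → 0 ≤ o.2 → o.2 + L ≤ N → FewExceptions D L m o) :
    ∃ g, D g ∧ ∀ o : ℤ × ℤ, 0 ≤ o.1 → o.1 + L ≤ N → 0 ≤ o.2 → o.2 + L ≤ N →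
      ∀ u, InCore D L o u → CellReach (NearCell M) D g u := by
  have h00 := h (0, 0) le_rfl (by simpa using hN) le_rfl (by simpa using hN)
  obtain ⟨g, hg, -⟩ := h00.exists_common_core_right hL
  have hLm : (m : ℤ) ≤ L := hL.le
  refine ⟨g, hg.dense, ?_⟩
  have hrow : ∀ i : ℤ, 0 ≤ i → i + L ≤ N → ∀ u, InCore D L (i, 0) u →
      CellReach (NearCell M) D g u := by
    intro i hi
    induction i, hi using Int.leInduction with
    | base => exact fun _ u hu => h00.cellReach_core hM hLm hg hu
    | succ i hi ih =>
      intro hiN u hu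
      obtain ⟨v, hv, hv'⟩ := (h (i, 0) hi (by simp only; omega) le_rfl
        (by simpa using hN)).exists_common_core_right hL
      exact (ih (by omega) v hv).trans ((h (i + 1, 0) (by simp only; omega) hiN le_rfl
        (by simpa using hN)).cellReach_core hM hLm hv' hu)
  have hall : ∀ i : ℤ, 0 ≤ i → i + L ≤ N → ∀ j : ℤ, 0 ≤ j → j + L ≤ N →
      ∀ u, InCore D L (i, j) u → CellReach (NearCell M) D g u := by
    intro i hi hiN j hj
    induction j, hj using Int.leInduction with
    | base => exact fun _ => hrow i hi hiN
    | succ j hj ih =>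
      intro hjN u hu
      obtain ⟨v, hv, hv'⟩ := (h (i, j) hi hiN hj (by simp only; omega)).exists_common_core_up hL
      exact (ih (by omega) v hv).trans ((h (i, j + 1) hi hiN (by simp only; omega)
        hjN).cellReach_core hM hLm hv' hu)
  exact fun o h1 h2 h3 h4 => hall o.1 h1 h2 o.2 h3 h4

/-- If fewer than `#B` cells of a window fail to satisfy `D`, where `B` is a set of offsets to the
right, then one can walk to the right from a cell on the left side of the window through `D` until
one meets a column that satisfies `D`. -/
lemma FewExceptions.exists_walk_right (hM : 3 ≤ M) {B : Finset (ℤ × ℤ)}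
    (hB : ∀ b ∈ B, 1 ≤ b.1 ∧ NearCell M b 0) (hBm : B.card = m) (hm : 1 ≤ m)
    (hL : L = 2 * (M * m + M) + 1) {c : ℤ × ℤ}
    (h : FewExceptions D L m (c.1, c.2 - (M * m + M))) :
    ∃ u, InCore D L (c.1, c.2 - (M * m + M)) u ∧ CellReach (NearCell M) D u c := by
  obtain ⟨a, y₀⟩ := c
  simp only at h ⊢
  have hm' : (1 : ℤ) ≤ m := by exact_mod_cast hm
  have hMm : (m : ℤ) * 3 ≤ M * m := by nlinarith
  obtain ⟨x₁, hx₁, hcol⟩ := h.exists_column (X := Finset.Ioc a (a + m))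
    (fun x hx => by rw [Finset.mem_Ioc] at hx; simp only; omega) (by rw [Int.card_Ioc]; omega)
  rw [Finset.mem_Ioc] at hx₁
  simp only at hcol
  -- Each step goes at least one cell to the right and fewer than `M` cells up or down. The cone
  -- condition therefore persists, and it keeps the walk and all its candidate cells inside the
  -- window.
  have main : ∀ k : ℕ, ∀ x y : ℤ, x₁ - x ≤ k → a ≤ x → x < x₁ → |y - y₀| ≤ M * (x - a) →
      ∃ y', y₀ - (M * m + M) ≤ y' ∧ y' < y₀ - (M * m + M) + L ∧
        CellReach (NearCell M) D (x₁, y') (x, y) := by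
    intro k
    induction k with
    | zero => intro x y h1 h2 h3; omega
    | succ k ih =>
      intro x y hk hax hx hy
      have hxa : M * (x - a) ≤ M * m - M := by nlinarith
      obtain ⟨hy1, hy2⟩ := abs_le.1 (hy.trans hxa)
      obtain ⟨b, hb, hD⟩ : ∃ b ∈ B, D ((x, y) + b) := by
        by_contra! hcon
        have := h (B.image fun b => (x, y) + b) (by
          intro u hu
          obtain ⟨b, hb, rfl⟩ := Finset.mem_image.1 hu
          refine ⟨?_, hcon b hb⟩
          obtain ⟨hb1, hbn⟩ := hB b hb
          obtain ⟨h1, h2⟩ := hbn.abs_lt (by omega)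
          simp only [Prod.fst_zero, Prod.snd_zero, sub_zero] at h1 h2
          have h3 := abs_lt.1 (show |b.1| < M by omega)
          have h4 := abs_lt.1 (show |b.2| < M by omega)
          simp only [InWindow, Prod.fst_add, Prod.snd_add]
          omega)
        rw [Finset.card_image_of_injective _ (add_right_injective _)] at this
        omega
      obtain ⟨hb1, hbn⟩ := hB b hb
      obtain ⟨-, h2⟩ := hbn.abs_lt (by omega)
      simp only [Prod.snd_zero, sub_zero] at h2
      obtain ⟨b₁, b₂⟩ := b
      simp only at hb1 h2
      simp only [Prod.mk_add_mk] at hD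
      by_cases hc : x + b₁ < x₁
      · obtain ⟨y', hy1', hy2', hr⟩ := ih (x + b₁) (y + b₂) (by omega) (by omega) hc (by
          have e1 : |y + b₂ - y₀| ≤ |y - y₀| + |b₂| := by
            rw [show y + b₂ - y₀ = (y - y₀) + b₂ by ring]; exact abs_add_le _ _
          nlinarith)
        refine ⟨y', hy1', hy2', hr.tail ⟨hD, hbn.of_le ?_ ?_⟩⟩
        · simp
        · simp
      -- The offset would reach or pass the full column `x₁`, so the cell of that column at the same
      -- height is at least as close and can replace it.
      · refine ⟨y, by omega, by omega, .single ⟨hcol y (by omega) (by omega), hbn.of_le ?_ ?_⟩⟩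
        · simp only [Prod.fst_zero, sub_zero]
          rw [abs_of_nonneg (by omega), abs_of_nonneg (by omega)]
          omega
        · simp
  obtain ⟨y', hy1, hy2, hr⟩ := main (x₁ - a).toNat a y₀ (by omega) le_rfl hx₁.1 (by simp)
  exact ⟨(x₁, y'), ⟨⟨by simp only; omega, by simp only; omega, hy1, hy2⟩, Or.inl hcol⟩, hr⟩

lemma exists_core_cellReach_of_snd {N : ℤ} (hM : 3 ≤ M) {B : Finset (ℤ × ℤ)}
    (hB : ∀ b ∈ B, 1 ≤ b.1 ∧ NearCell M b 0) (hBm : B.card = m) (hm : 1 ≤ m)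
    (hL : L = 2 * (M * m + M) + 1) (hN : 2 * L ≤ N)
    (h : ∀ o : ℤ × ℤ, 0 ≤ o.1 → o.1 + L ≤ N → 0 ≤ o.2 → o.2 + L ≤ N → FewExceptions D L m o)
    {c : ℤ × ℤ} (hc0 : 0 ≤ c.1) (hcN : c.1 < N) (hc : L ≤ c.2) (hc' : c.2 < N - L) :
    ∃ o : ℤ × ℤ, (0 ≤ o.1 ∧ o.1 + L ≤ N ∧ 0 ≤ o.2 ∧ o.2 + L ≤ N) ∧
      ∃ u, InCore D L o u ∧ CellReach (NearCell M) D u c := by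
  have hMm : 0 ≤ M * m := by positivity
  by_cases hcase : 2 * c.1 < N
  · refine ⟨(c.1, c.2 - (M * m + M)), ⟨hc0, ?_, ?_, ?_⟩,
      (h (c.1, c.2 - (M * m + M)) hc0 ?_ ?_ ?_).exists_walk_right hM hB hBm hm hL⟩ <;>
        simp only <;> omega
  -- In the right half there may be no room for a window to the right; the grid is reflected.
  · set σ : ℤ × ℤ → ℤ × ℤ := fun u => (N - 1 - u.1, u.2) with hσ
    have hσi : Function.Injective σ := by
      rintro ⟨x, y⟩ ⟨x', y'⟩ he
      simp only [hσ, Prod.mk.injEq] at he ⊢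
      omega
    have hσn : ∀ u v, NearCell M u v → NearCell M (σ u) (σ v) := by
      intro u v huv
      refine huv.of_le ?_ le_rfl
      simp only [hσ]
      rw [show N - 1 - u.1 - (N - 1 - v.1) = v.1 - u.1 by ring, abs_sub_comm]
    have hf : FewExceptions (D ∘ σ) L m ((σ c).1, (σ c).2 - (M * m + M)) := by
      refine FewExceptions.comp hσi (o := (c.1 + 1 - L, c.2 - (M * m + M))) ?_
        (h _ ?_ ?_ ?_ ?_)
      · rintro ⟨x, y⟩ hu
        simp only [InWindow, hσ] at hu ⊢
        omega
      all_goals simp only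
      all_goals omega
    obtain ⟨u, hu, hr⟩ := hf.exists_walk_right hM hB hBm hm hL
    refine ⟨(c.1 + 1 - L, c.2 - (M * m + M)), ?_, σ u, ?_, ?_⟩
    · simp only; omega
    · obtain ⟨hw, hor⟩ := hu
      refine ⟨?_, ?_⟩
      · simp only [InWindow, hσ] at hw ⊢
        omega
      · rcases hor with hcol | hrow
        · exact Or.inl hcol
        · refine Or.inr fun x hx1 hx2 => ?_
          have := hrow (N - 1 - x) (by simp only [hσ] at hx2 ⊢; omega)
            (by simp only [hσ] at hx1 ⊢; omega)
          simpa [hσ] using this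
    · have := hr.map hσn
      have e : σ (σ c) = c := by simp [hσ]
      rwa [e] at this

/-- If all windows have few exceptions and the four corner windows have none, then all cells are
reachable. -/
theorem exists_cellReach_of_fewExceptions {N : ℤ} (hM : 3 ≤ M) {B : Finset (ℤ × ℤ)}
    (hB : ∀ b ∈ B, 1 ≤ b.1 ∧ NearCell M b 0) (hBm : B.card = m) (hm : 1 ≤ m)
    (hL : L = 2 * (M * m + M) + 1) (hN : 2 * L ≤ N)
    (h : ∀ o : ℤ × ℤ, 0 ≤ o.1 → o.1 + L ≤ N → 0 ≤ o.2 → o.2 + L ≤ N → FewExceptions D L m o)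
    (hcorner : ∀ u : ℤ × ℤ, (0 ≤ u.1 ∧ u.1 < L ∨ N - L ≤ u.1 ∧ u.1 < N) →
      (0 ≤ u.2 ∧ u.2 < L ∨ N - L ≤ u.2 ∧ u.2 < N) → D u) :
    ∃ g, D g ∧ ∀ c : ℤ × ℤ, 0 ≤ c.1 → c.1 < N → 0 ≤ c.2 → c.2 < N →
      CellReach (NearCell M) D g c := by
  have hm' : (1 : ℤ) ≤ m := by exact_mod_cast hm
  have hmM : (m : ℤ) * 3 ≤ M * m := by nlinarith
  obtain ⟨g, hg, hreach⟩ := exists_cellReach_core (N := N) hM (show (m : ℤ) < L by omega)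
    (by omega) h
  refine ⟨g, hg, ?_⟩
  rintro ⟨x, y⟩ hx hxN hy hyN
  simp only at hx hxN hy hyN
  by_cases hy' : L ≤ y ∧ y < N - L
  · obtain ⟨o, ⟨h1, h2, h3, h4⟩, u, hu, hr⟩ :=
      exists_core_cellReach_of_snd (c := (x, y)) hM hB hBm hm hL hN h hx hxN hy'.1 hy'.2
    exact (hreach o h1 h2 h3 h4 u hu).trans hr
  by_cases hx' : L ≤ x ∧ x < N - L
  · obtain ⟨o, ⟨h1, h2, h3, h4⟩, u, hu, hr⟩ :=
      exists_core_cellReach_of_snd (D := D ∘ Prod.swap) (c := (y, x)) hM hB hBm hm hL hN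
        (fun o h1 h2 h3 h4 => (h o.swap h3 h4 h1 h2).swap) hy hyN hx'.1 hx'.2
    exact (hreach o.swap h3 h4 h1 h2 u.swap hu.swap).trans  (cellReach_swap hr)
  -- The cell is now within `L` of a horizontal and of a vertical side. Its corner window consists
  -- of cells satisfying `D`, so the cell lies in the core of that window.
  obtain ⟨i, hi, hiN, hix, hix', hi'⟩ : ∃ i : ℤ, 0 ≤ i ∧ i + L ≤ N ∧ i ≤ x ∧ x < i + L ∧
      (i = 0 ∨ i = N - L) := by
    by_cases hxL : x < L
    · exact ⟨0, by omega⟩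
    · exact ⟨N - L, by omega⟩
  obtain ⟨j, hj, hjN, hjy, hjy', hj'⟩ : ∃ j : ℤ, 0 ≤ j ∧ j + L ≤ N ∧ j ≤ y ∧ y < j + L ∧
      (j = 0 ∨ j = N - L) := by
    by_cases hyL : y < L
    · exact ⟨0, by omega⟩
    · exact ⟨N - L, by omega⟩
  refine hreach (i, j) hi hiN hj hjN (x, y) ⟨⟨hix, hix', hjy, hjy'⟩, Or.inl ?_⟩
  intro z hz1 hz2
  simp only at hz1 hz2
  exact hcorner (x, z) (by simp only; omega) (by simp only; omega)

end Windows

/-! ### Probabilities as finite weighted sums -/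

open Classical in
/-- The probability of the event `E` for `n` independent random elements of the finite set `box`
with weights `w`. -/
noncomputable def weightSum {C : Type*} (n : ℕ) (w : C → ℝ) (box : Finset C)
    (E : (Fin n → C) → Prop) : ℝ :=
  ∑ κ ∈ (Fintype.piFinset fun _ : Fin n => box) with E κ, ∏ i, w (κ i)

section WeightSum

variable {C : Type*} {n : ℕ} {w : C → ℝ} {box : Finset C}

lemma weightSum_mono (hw : ∀ c, 0 ≤ w c) {E E' : (Fin n → C) → Prop}
    (h : ∀ κ, (∀ i, κ i ∈ box) → E κ → E' κ) : weightSum n w box E ≤ weightSum n w box E' := by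
  classical
  unfold weightSum
  refine Finset.sum_le_sum_of_subset_of_nonneg ?_
    fun κ _ _ => Finset.prod_nonneg fun i _ => hw _
  intro κ hκ
  rw [Finset.mem_filter] at hκ ⊢
  exact ⟨hκ.1, h κ (Fintype.mem_piFinset.1 hκ.1) hκ.2⟩

lemma weightSum_le_sum {E : (Fin n → C) → Prop} {g : (Fin n → C) → ℝ} (hg : ∀ κ, 0 ≤ g κ)
    (h : ∀ κ, E κ → ∏ i, w (κ i) ≤ g κ) :
    weightSum n w box E ≤ ∑ κ ∈ Fintype.piFinset fun _ : Fin n => box, g κ := by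
  classical
  unfold weightSum
  exact (Finset.sum_le_sum fun κ hκ => h κ (Finset.mem_filter.1 hκ).2).trans
    (Finset.sum_le_sum_of_subset_of_nonneg (Finset.filter_subset _ _) fun κ _ _ => hg κ)

lemma weightSum_exists_le (hw : ∀ c, 0 ≤ w c) {ι : Type*} (F : Finset ι)
    (E : ι → (Fin n → C) → Prop) :
    weightSum n w box (fun κ => ∃ a ∈ F, E a κ) ≤ ∑ a ∈ F, weightSum n w box (E a) := by
  classical
  have hnn : ∀ κ : Fin n → C, 0 ≤ ∏ i, w (κ i) := fun κ => Finset.prod_nonneg fun i _ => hw _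
  unfold weightSum
  simp only [Finset.sum_filter]
  rw [Finset.sum_comm]
  refine Finset.sum_le_sum fun κ _ => ?_
  have hterm : ∀ a ∈ F, 0 ≤ if E a κ then ∏ i, w (κ i) else 0 := fun a _ => by
    split_ifs
    · exact hnn κ
    · exact le_rfl
  split_ifs with h
  · obtain ⟨a, ha, hE⟩ := h
    refine le_trans ?_ (Finset.single_le_sum hterm ha)
    rw [if_pos hE]
  · exact Finset.sum_nonneg hterm

lemma weightSum_or_le (hw : ∀ c, 0 ≤ w c) (E E' : (Fin n → C) → Prop) :
    weightSum n w box (fun κ => E κ ∨ E' κ) ≤ weightSum n w box E + weightSum n w box E' := by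
  classical
  have hnn : ∀ κ : Fin n → C, 0 ≤ ∏ i, w (κ i) := fun κ => Finset.prod_nonneg fun i _ => hw _
  unfold weightSum
  simp only [Finset.sum_filter]
  rw [← Finset.sum_add_distrib]
  refine Finset.sum_le_sum fun κ _ => ?_
  have := hnn κ
  by_cases h : E κ <;> by_cases h' : E' κ <;> simp [h, h', this]

/-- Markov's inequality for the number of indices with a property. -/
lemma mul_weightSum_card_le (hw : ∀ c, 0 ≤ w c) (Q : Fin n → (Fin n → C) → Prop)
    [∀ κ, DecidablePred fun i => Q i κ] (a : ℝ) :
    a * weightSum n w box (fun κ => a < (Finset.univ.filter fun i => Q i κ).card) ≤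
      ∑ i, weightSum n w box (Q i) := by
  classical
  unfold weightSum
  have hnn : ∀ κ : Fin n → C, 0 ≤ ∏ i, w (κ i) := fun κ => Finset.prod_nonneg fun i _ => hw _
  simp only [Finset.sum_filter]
  rw [Finset.sum_comm, Finset.mul_sum]
  refine Finset.sum_le_sum fun κ _ => ?_
  have e : ∑ i, (if Q i κ then ∏ j, w (κ j) else 0) =
      (Finset.univ.filter fun i => Q i κ).card * ∏ j, w (κ j) := by
    rw [← Finset.sum_filter, Finset.sum_const, nsmul_eq_mul]
  refine le_of_le_of_eq ?_ (e.symm.trans (Finset.sum_congr rfl fun i _ => by congr))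
  split_ifs with h
  · exact mul_le_mul_of_nonneg_right h.le (hnn κ)
  · rw [mul_zero]
    exact mul_nonneg (Nat.cast_nonneg _) (hnn κ)

/-- An exponential moment bound for the event that all the cells in `T` contain fewer than `K` of
the points. -/
lemma weightSum_sparse_le [DecidableEq C] (hw : ∀ c, 0 ≤ w c) (hw1 : ∑ c ∈ box, w c = 1) {p t : ℝ}
    (ht : 0 ≤ t) {A T : Finset C} (hA : A ⊆ box) (hT : T ⊆ box) (hp : ∀ c ∈ T, p ≤ w c) (K : ℕ)
    (i : Fin n) :
    weightSum n w box (fun κ => κ i ∈ A ∧ ∀ c ∈ T, cellCount κ c < K) ≤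
      (∑ c ∈ A, w c) * Real.exp (t * K - (1 - Real.exp (-t)) * ((n - 1 : ℕ) * p)) ^ T.card := by
  classical
  -- Points in `T` are discounted by `exp (-t)`. The index `i` is exempt, being reserved for the
  -- condition `κ i ∈ A`; hence `n - 1` in the bound.
  set e : C → ℝ := fun c => if c ∈ T then Real.exp (-t) else 1 with he
  set h : Fin n → C → ℝ := fun j c => if j = i then (if c ∈ A then w c else 0) else w c * e c
    with hh
  have he0 : ∀ c, 0 ≤ e c := fun c => by
    simp only [he]; split_ifs
    · exact (Real.exp_pos _).le
    · exact zero_le_one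
  have hh0 : ∀ j c, 0 ≤ h j c := fun j c => by
    simp only [hh]
    split_ifs
    · exact hw c
    · exact le_rfl
    · exact mul_nonneg (hw c) (he0 c)
  have hterm : ∀ κ : Fin n → C, κ i ∈ A → (∀ c ∈ T, cellCount κ c < K) →
      ∏ j, w (κ j) ≤ Real.exp (t * K) ^ T.card * ∏ j, h j (κ j) := by
    intro κ hκA hκT
    have e1 : ∏ j, h j (κ j) = (∏ j, w (κ j)) * ∏ j ∈ Finset.univ.erase i, e (κ j) := by
      rw [← Finset.mul_prod_erase _ _ (Finset.mem_univ i),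
        ← Finset.mul_prod_erase _ (fun j => w (κ j)) (Finset.mem_univ i), mul_assoc,
        ← Finset.prod_mul_distrib]
      congr 1
      · simp [hh, hκA]
      · refine Finset.prod_congr rfl fun j hj => ?_
        simp [hh, Finset.ne_of_mem_erase hj]
    have e2 : ∏ j ∈ Finset.univ.erase i, e (κ j) =
        Real.exp (-t) ^ ((Finset.univ.erase i).filter fun j => κ j ∈ T).card := by
      simp only [he]
      rw [← Finset.prod_filter, Finset.prod_const]
    have e3 : ((Finset.univ.erase i).filter fun j => κ j ∈ T).card ≤ T.card * K := by
      calc _ ≤ (T.biUnion fun c => Finset.univ.filter fun j => κ j = c).card := by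
            refine Finset.card_le_card fun j hj => ?_
            simp only [Finset.mem_filter, Finset.mem_biUnion, Finset.mem_univ, true_and] at hj ⊢
            exact ⟨κ j, hj.2, rfl⟩
        _ ≤ T.card * K := Finset.card_biUnion_le_card_mul _ _ _ fun c hc => (hκT c hc).le
    have hprod : 0 ≤ ∏ j, w (κ j) := Finset.prod_nonneg fun i _ => hw _
    rw [e1, e2]
    -- On the event the cells of `T` hold at most `T.card * K` points, so the tilted weight with its
    -- prefactor dominates the original one.
    have e4 : (1 : ℝ) ≤ Real.exp (t * K) ^ T.card *
        Real.exp (-t) ^ ((Finset.univ.erase i).filter fun j => κ j ∈ T).card := by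
      rw [← Real.exp_nat_mul, ← Real.exp_nat_mul, ← Real.exp_add]
      apply Real.one_le_exp
      have : (((Finset.univ.erase i).filter fun j => κ j ∈ T).card : ℝ) ≤ T.card * K := by
        exact_mod_cast e3
      nlinarith
    nlinarith
  have hsum : weightSum n w box (fun κ => κ i ∈ A ∧ ∀ c ∈ T, cellCount κ c < K) ≤
      Real.exp (t * K) ^ T.card * ∏ j, ∑ c ∈ box, h j c := by
    rw [Finset.prod_univ_sum, Finset.mul_sum]
    exact weightSum_le_sum (fun κ => mul_nonneg (by positivity)
      (Finset.prod_nonneg fun j _ => hh0 _ _)) fun κ hκ => hterm κ hκ.1 hκ.2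
  have hi : ∑ c ∈ box, h i c = ∑ c ∈ A, w c := by
    simp only [hh, if_true]
    rw [← Finset.sum_filter, Finset.filter_mem_eq_inter, Finset.inter_eq_right.2 hA]
  have hj : ∀ j ∈ Finset.univ.erase i, ∑ c ∈ box, h j c ≤
      Real.exp (-((1 - Real.exp (-t)) * (T.card * p))) := by
    intro j hj
    have hji := Finset.ne_of_mem_erase hj
    have e1 : ∑ c ∈ box, h j c = 1 - (1 - Real.exp (-t)) * ∑ c ∈ T, w c := by
      have : ∀ c, h j c = w c - (if c ∈ T then (1 - Real.exp (-t)) * w c else 0) := by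
        intro c
        simp only [hh, he, hji, if_false]
        split_ifs <;> ring
      simp only [this]
      rw [Finset.sum_sub_distrib, hw1, ← Finset.sum_filter, Finset.filter_mem_eq_inter,
        Finset.inter_eq_right.2 hT, Finset.mul_sum]
    have e2 : T.card * p ≤ ∑ c ∈ T, w c := by
      rw [← nsmul_eq_mul]; exact Finset.card_nsmul_le_sum _ _ _ hp
    have e3 : 0 ≤ 1 - Real.exp (-t) := by
      have : Real.exp (-t) ≤ 1 := Real.exp_le_one_iff.2 (by linarith)
      linarith
    rw [e1]
    have e4 := mul_le_mul_of_nonneg_left e2 e3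
    have e5 := Real.add_one_le_exp (-((1 - Real.exp (-t)) * (T.card * p)))
    linarith
  refine hsum.trans ?_
  rw [← Finset.mul_prod_erase _ _ (Finset.mem_univ i), hi]
  have hprod : ∏ j ∈ Finset.univ.erase i, ∑ c ∈ box, h j c ≤
      Real.exp (-((1 - Real.exp (-t)) * (T.card * p))) ^ (n - 1) := by
    refine (Finset.prod_le_prod (fun j _ => Finset.sum_nonneg fun c _ => hh0 j c) hj).trans ?_
    rw [Finset.prod_const, Finset.card_erase_of_mem (Finset.mem_univ _), Finset.card_univ,
      Fintype.card_fin]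
  have hA0 : 0 ≤ ∑ c ∈ A, w c := Finset.sum_nonneg fun c _ => hw c
  calc Real.exp (t * K) ^ T.card * ((∑ c ∈ A, w c) * ∏ j ∈ Finset.univ.erase i, ∑ c ∈ box, h j c)
      ≤ Real.exp (t * K) ^ T.card * ((∑ c ∈ A, w c) *
          Real.exp (-((1 - Real.exp (-t)) * (T.card * p))) ^ (n - 1)) := by gcongr
    _ = (∑ c ∈ A, w c) *
        Real.exp (t * K - (1 - Real.exp (-t)) * ((n - 1 : ℕ) * p)) ^ T.card := by
      rw [mul_left_comm, ← Real.exp_nat_mul, ← Real.exp_nat_mul, ← Real.exp_nat_mul,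
        ← Real.exp_add]
      congr 2
      ring

end WeightSum

/-- A lower bound for the probability of an event that happens whenever the cells of the points
`X i` do not have the property `Bad`. -/
lemma one_sub_weightSum_le {Ω E C : Type*} [MeasurableSpace Ω] {P : Measure Ω}
    [IsProbabilityMeasure P] [MeasurableSpace E] [MeasurableSpace C] [MeasurableSingletonClass C]
    {μ : Measure E} {n : ℕ} {X : Fin n → Ω → E} (hX : iIndepFun X P) (hlaw : ∀ i, HasLaw (X i) μ P)
    {s : Set E} (hs : MeasurableSet s) (hμs : μ sᶜ = 0) {ψ : E → C} (hψ : Measurable ψ)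
    {box : Finset C} (hbox : ∀ x ∈ s, ψ x ∈ box) {S : Set Ω} {Bad : (Fin n → C) → Prop}
    (hS : ∀ ω, (∀ i, X i ω ∈ s) → ¬ Bad (fun i => ψ (X i ω)) → ω ∈ S) :
    1 - weightSum n (fun c => μ.real (ψ ⁻¹' {c})) box Bad ≤ P.real S := by
  classical
  have hmeas : ∀ (i : Fin n) {A : Set E}, MeasurableSet A → P.real (X i ⁻¹' A) = μ.real A := by
    intro i A hA
    rw [Measure.real, Measure.real, ← (hlaw i).map_eq,
      Measure.map_apply_of_aemeasurable (hlaw i).aemeasurable hA]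
  -- Covering the whole space and using subadditivity avoids any measurability requirement on `S`.
  have hcover : (Set.univ : Set Ω) ⊆ S ∪ ((⋃ i ∈ (Finset.univ : Finset (Fin n)), X i ⁻¹' sᶜ) ∪
      ⋃ κ ∈ (Fintype.piFinset fun _ : Fin n => box).filter Bad,
        ⋂ i, X i ⁻¹' (ψ ⁻¹' {κ i})) := by
    intro ω _
    by_cases h1 : ∀ i, X i ω ∈ s
    · by_cases h2 : Bad fun i => ψ (X i ω)
      · refine Or.inr (Or.inr ?_)
        simp only [Set.mem_iUnion]
        refine ⟨fun i => ψ (X i ω), ?_, ?_⟩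
        · rw [Finset.mem_filter, Fintype.mem_piFinset]
          exact ⟨fun i => hbox _ (h1 i), h2⟩
        · simp
      · exact Or.inl (hS ω h1 h2)
    · push Not at h1
      obtain ⟨i, hi⟩ := h1
      refine Or.inr (Or.inl ?_)
      simp only [Set.mem_iUnion]
      exact ⟨i, Finset.mem_univ _, hi⟩
  have h1 : (1 : ℝ) ≤ _ := (probReal_univ (μ := P)).symm.le.trans (measureReal_mono hcover)
  have h2 := measureReal_union_le (μ := P) S
    ((⋃ i ∈ (Finset.univ : Finset (Fin n)), X i ⁻¹' sᶜ) ∪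
      ⋃ κ ∈ (Fintype.piFinset fun _ : Fin n => box).filter Bad, ⋂ i, X i ⁻¹' (ψ ⁻¹' {κ i}))
  have h3 := measureReal_union_le (μ := P) (⋃ i ∈ (Finset.univ : Finset (Fin n)), X i ⁻¹' sᶜ)
      (⋃ κ ∈ (Fintype.piFinset fun _ : Fin n => box).filter Bad, ⋂ i, X i ⁻¹' (ψ ⁻¹' {κ i}))
  have h4 := measureReal_biUnion_finset_le (μ := P) (Finset.univ : Finset (Fin n))
    fun i => X i ⁻¹' sᶜ
  have h5 := measureReal_biUnion_finset_le (μ := P)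
    ((Fintype.piFinset fun _ : Fin n => box).filter Bad) fun κ => ⋂ i, X i ⁻¹' (ψ ⁻¹' {κ i})
  have h6 : ∑ i : Fin n, P.real (X i ⁻¹' sᶜ) = 0 := by
    refine Finset.sum_eq_zero fun i _ => ?_
    rw [hmeas i hs.compl, Measure.real, hμs, ENNReal.toReal_zero]
  have h7 : ∀ κ : Fin n → C, P.real (⋂ i, X i ⁻¹' (ψ ⁻¹' {κ i})) =
      ∏ i, μ.real (ψ ⁻¹' {κ i}) := by
    intro κ
    have hm : ∀ i, MeasurableSet (ψ ⁻¹' {κ i}) := fun i => hψ (measurableSet_singleton _)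
    rw [Measure.real, hX.meas_iInter fun i => ⟨_, hm i, rfl⟩, ENNReal.toReal_prod]
    exact Finset.prod_congr rfl fun i _ => hmeas i (hm i)
  simp only [h7] at h5
  unfold weightSum
  convert! (show 1 - ∑ κ ∈ (Fintype.piFinset fun _ : Fin n => box).filter Bad,
      ∏ i, μ.real (ψ ⁻¹' {κ i}) ≤ P.real S by linarith)

/-! ### The grid on the unit square -/

/-- The index of the cell of a point of `[-1/2, 1/2]`, when it is divided into `N` equal cells. -/
noncomputable def cellIndex (N : ℤ) (x : ℝ) : ℤ := min ⌊(x + 1 / 2) * N⌋ (N - 1)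

/-- The cell of a point of the unit square, when it is divided into `N × N` equal cells. -/
noncomputable def gridCell (N : ℤ) (x : Plane) : ℤ × ℤ := (cellIndex N (x 0), cellIndex N (x 1))

/-- The indices of the cells of the unit square. -/
noncomputable def gridBox (N : ℤ) : Finset (ℤ × ℤ) := Finset.Ico 0 N ×ˢ Finset.Ico 0 N

lemma mem_gridBox {N : ℤ} {c : ℤ × ℤ} :
    c ∈ gridBox N ↔ (0 ≤ c.1 ∧ c.1 < N) ∧ 0 ≤ c.2 ∧ c.2 < N := by
  rw [gridBox, Finset.mem_product, Finset.mem_Ico, Finset.mem_Ico]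

section CellIndex

variable {N : ℤ} {x : ℝ}

lemma cellIndex_nonneg (hN : 1 ≤ N) (hx : x ∈ Set.Icc (-(1 / 2) : ℝ) (1 / 2)) :
    0 ≤ cellIndex N x := by
  have hN' : (0 : ℝ) ≤ N := by exact_mod_cast (by omega : (0 : ℤ) ≤ N)
  refine le_min (Int.floor_nonneg.2 (mul_nonneg ?_ hN')) (by omega)
  linarith [hx.1]

lemma cellIndex_lt : cellIndex N x < N := (min_le_right _ _).trans_lt (by omega)

lemma cellIndex_le : (cellIndex N x : ℝ) ≤ (x + 1 / 2) * N :=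
  le_trans (by exact_mod_cast min_le_left _ _) (Int.floor_le _)

lemma le_cellIndex_add_one (hN : 1 ≤ N) (hx : x ∈ Set.Icc (-(1 / 2) : ℝ) (1 / 2)) :
    (x + 1 / 2) * N ≤ cellIndex N x + 1 := by
  have hN' : (0 : ℝ) ≤ N := by exact_mod_cast (by omega : (0 : ℤ) ≤ N)
  rcases min_choice ⌊(x + 1 / 2) * N⌋ (N - 1) with h | h
  · rw [cellIndex, h]
    exact (Int.lt_floor_add_one _).le
  · rw [cellIndex, h]
    push_cast
    have : (x + 1 / 2) * N ≤ 1 * N := mul_le_mul_of_nonneg_right (by linarith [hx.2]) hN'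
    linarith

lemma cellIndex_eq {k : ℤ} (hk : k < N) (h1 : (k : ℝ) ≤ (x + 1 / 2) * N)
    (h2 : (x + 1 / 2) * N < k + 1) : cellIndex N x = k := by
  rw [cellIndex, Int.floor_eq_iff.2 ⟨h1, h2⟩]
  exact min_eq_left (by omega)

lemma measurable_cellIndex : Measurable (cellIndex N) := by
  unfold cellIndex
  exact (Int.measurable_floor.comp (by fun_prop)).min measurable_const

lemma measurable_gridCell : Measurable (gridCell N) := by
  unfold gridCell
  exact (measurable_cellIndex.comp (by fun_prop)).prodMk (measurable_cellIndex.comp (by fun_prop))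

lemma gridCell_mem_gridBox (hN : 1 ≤ N) {x : Plane} (hx : x ∈ unitSquare) :
    gridCell N x ∈ gridBox N :=
  mem_gridBox.2 ⟨⟨cellIndex_nonneg hN (hx 0), cellIndex_lt⟩, cellIndex_nonneg hN (hx 1),
    cellIndex_lt⟩

/-- The bound is not strict, because points with coordinate `1 / 2` are put into the last cell; the
strict inequality in `NearCell` makes up for this. -/
lemma abs_sub_mul_le (hN : 1 ≤ N) {y : ℝ} (hx : x ∈ Set.Icc (-(1 / 2) : ℝ) (1 / 2))
    (hy : y ∈ Set.Icc (-(1 / 2) : ℝ) (1 / 2)) :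
    |x - y| * N ≤ |cellIndex N x - cellIndex N y| + 1 := by
  have hN' : (0 : ℝ) ≤ N := by exact_mod_cast (by omega : (0 : ℤ) ≤ N)
  have h1 := le_cellIndex_add_one hN hx
  have h2 := le_cellIndex_add_one hN hy
  have h3 : (cellIndex N x : ℝ) ≤ _ := cellIndex_le
  have h4 : (cellIndex N y : ℝ) ≤ _ := cellIndex_le
  have h5 := le_abs_self (cellIndex N x - cellIndex N y : ℝ)
  have h6 := neg_abs_le (cellIndex N x - cellIndex N y : ℝ)
  push_cast
  rw [show |x - y| * (N : ℝ) = |(x - y) * N| by rw [abs_mul, abs_of_nonneg hN'], abs_le]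
  constructor <;> nlinarith

lemma dist_lt_of_nearCell {M : ℤ} {r : ℝ} (hM : 0 ≤ M) (hN : 1 ≤ N) (hMr : (M : ℝ) ≤ N * r)
    {x y : Plane} (hx : x ∈ unitSquare) (hy : y ∈ unitSquare)
    (h : NearCell M (gridCell N x) (gridCell N y)) : dist x y < r := by
  have hN' : (0 : ℝ) < N := by exact_mod_cast (by omega : (0 : ℤ) < N)
  have hM' : (0 : ℝ) ≤ M := by exact_mod_cast hM
  have hr : 0 ≤ r := nonneg_of_mul_nonneg_right (hM'.trans hMr) hN'
  have h0 := abs_sub_mul_le hN (hx 0) (hy 0)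
  have h1 := abs_sub_mul_le hN (hx 1) (hy 1)
  have h' : ((|cellIndex N (x 0) - cellIndex N (y 0)| : ℤ) + 1 : ℝ) ^ 2 +
      ((|cellIndex N (x 1) - cellIndex N (y 1)| : ℤ) + 1 : ℝ) ^ 2 < (M : ℝ) ^ 2 := by
    exact_mod_cast h
  have e0 : (|x 0 - y 0| * N) ^ 2 ≤ _ := pow_le_pow_left₀ (by positivity) h0 2
  have e1 : (|x 1 - y 1| * N) ^ 2 ≤ _ := pow_le_pow_left₀ (by positivity) h1 2
  have e2 : (M : ℝ) ^ 2 ≤ (N * r) ^ 2 := pow_le_pow_left₀ hM' hMr 2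
  rw [EuclideanSpace.dist_eq, Fin.sum_univ_two, Real.dist_eq, Real.dist_eq]
  rw [Real.sqrt_lt' (lt_of_le_of_ne hr ?_)]
  · have e3 : (|x 0 - y 0| ^ 2 + |x 1 - y 1| ^ 2) * N ^ 2 < r ^ 2 * N ^ 2 := by
      rw [mul_pow] at e0 e1 e2
      linarith
    exact lt_of_mul_lt_mul_right e3 (by positivity)
  · rintro rfl
    rw [mul_zero] at e2
    have : 0 ≤ (|x 0 - y 0| * (N : ℝ)) ^ 2 := by positivity
    have : 0 ≤ (|x 1 - y 1| * (N : ℝ)) ^ 2 := by positivity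
    linarith

lemma nearCell_of_eq {M : ℤ} (hM : 2 ≤ M) (u : ℤ × ℤ) : NearCell M u u := by
  unfold NearCell
  simp only [sub_self, abs_zero]
  nlinarith

end CellIndex

lemma measurableSet_unitSquare : MeasurableSet unitSquare := by
  have : unitSquare = ⋂ i, (fun x : Plane => x i) ⁻¹' Set.Icc (-(1 / 2) : ℝ) (1 / 2) := by
    ext x; simp [unitSquare]
  rw [this]
  exact MeasurableSet.iInter fun i => (by fun_prop : Measurable fun x : Plane => x i)
    measurableSet_Icc

lemma squareLaw_compl_unitSquare (f : Plane → ℝ) : squareLaw f unitSquareᶜ = 0 := by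
  refine withDensity_absolutelyContinuous _ _ ?_
  rw [Measure.restrict_apply measurableSet_unitSquare.compl, Set.compl_inter_self, measure_empty]

lemma volume_openBox (a b : Fin 2 → ℝ) :
    volume {x : Plane | ∀ i, x i ∈ Set.Ioo (a i) (b i)} = ∏ i, ENNReal.ofReal (b i - a i) := by
  rw [← Real.volume_pi_Ioo, ← (PiLp.volume_preserving_ofLp (Fin 2)).measure_preimage
    (MeasurableSet.univ_pi fun i => measurableSet_Ioo).nullMeasurableSet]
  congr 1
  ext x
  simp

lemma le_squareLaw_gridCell {f : Plane → ℝ} (hfm : Measurable f) {a : ℝ} (ha : 0 ≤ a)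
    (hfa : ∀ x ∈ unitSquare, a ≤ f x) [IsProbabilityMeasure (squareLaw f)] {N : ℤ} (hN : 1 ≤ N)
    {c : ℤ × ℤ} (hc : c ∈ gridBox N) :
    a / N ^ 2 ≤ (squareLaw f).real (gridCell N ⁻¹' {c}) := by
  obtain ⟨⟨h1, h2⟩, h3, h4⟩ := mem_gridBox.1 hc
  have hN' : (0 : ℝ) < N := by exact_mod_cast (by omega : (0 : ℤ) < N)
  set lo : Fin 2 → ℝ := ![c.1 / N - 1 / 2, c.2 / N - 1 / 2] with hlo
  set hi : Fin 2 → ℝ := ![(c.1 + 1) / N - 1 / 2, (c.2 + 1) / N - 1 / 2] with hhi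
  set B : Set Plane := {x | ∀ i, x i ∈ Set.Ioo (lo i) (hi i)} with hB
  have hcoord : ∀ (k : ℤ) (t : ℝ), t ∈ Set.Ioo ((k : ℝ) / N - 1 / 2) ((k + 1) / N - 1 / 2) →
      (k : ℝ) ≤ (t + 1 / 2) * N ∧ (t + 1 / 2) * N < k + 1 := by
    intro k t ht
    have e1 : (k : ℝ) / N < t + 1 / 2 := by linarith [ht.1]
    have e2 : t + 1 / 2 < (k + 1) / N := by linarith [ht.2]
    rw [div_lt_iff₀ hN'] at e1
    rw [lt_div_iff₀ hN'] at e2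
    exact ⟨e1.le, e2⟩
  have hsq : ∀ (k : ℤ) (t : ℝ), 0 ≤ k → k < N → (k : ℝ) ≤ (t + 1 / 2) * N →
      (t + 1 / 2) * N < k + 1 → t ∈ Set.Icc (-(1 / 2) : ℝ) (1 / 2) := by
    intro k t hk hkN e1 e2
    have hk' : (0 : ℝ) ≤ k := by exact_mod_cast hk
    have hkN' : (k : ℝ) + 1 ≤ N := by exact_mod_cast hkN
    constructor <;> nlinarith
  have hBc : ∀ x ∈ B, gridCell N x = c ∧ x ∈ unitSquare := by
    intro x hx
    obtain ⟨a0, b0⟩ := hcoord c.1 (x 0) (by simpa [hlo, hhi] using hx 0)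
    obtain ⟨a1, b1⟩ := hcoord c.2 (x 1) (by simpa [hlo, hhi] using hx 1)
    refine ⟨Prod.ext (cellIndex_eq h2 a0 b0) (cellIndex_eq h4 a1 b1), ?_⟩
    intro i
    fin_cases i
    · exact hsq c.1 (x 0) h1 h2 a0 b0
    · exact hsq c.2 (x 1) h3 h4 a1 b1
  have hBm : MeasurableSet B := by
    have : B = ⋂ i, (fun x : Plane => x i) ⁻¹' Set.Ioo (lo i) (hi i) := by
      ext x; simp [hB]
    rw [this]
    exact MeasurableSet.iInter fun i => (by fun_prop : Measurable fun x : Plane => x i)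
      measurableSet_Ioo
  have hvol : volume B = ENNReal.ofReal (1 / N ^ 2) := by
    rw [hB, volume_openBox, Fin.prod_univ_two, ← ENNReal.ofReal_mul]
    · congr 1
      simp only [hlo, hhi, Matrix.cons_val_zero, Matrix.cons_val_one]
      field_simp
      ring
    · simp only [hlo, hhi, Matrix.cons_val_zero]
      have : ((c.1 : ℝ) + 1) / N - 1 / 2 - (c.1 / N - 1 / 2) = 1 / N := by field_simp; ring
      rw [this]; positivity
  have hle : ENNReal.ofReal (a / N ^ 2) ≤ squareLaw f (gridCell N ⁻¹' {c}) := by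
    calc ENNReal.ofReal (a / N ^ 2) = ENNReal.ofReal a * volume B := by
          rw [hvol, ← ENNReal.ofReal_mul ha]; congr 1; ring
      _ = ∫⁻ _x in B, ENNReal.ofReal a := by rw [setLIntegral_const]
      _ ≤ ∫⁻ x in B, ENNReal.ofReal (f x) :=
          setLIntegral_mono (by fun_prop)
            fun x hx => ENNReal.ofReal_le_ofReal (hfa x (hBc x hx).2)
      _ = squareLaw f B := by
          rw [squareLaw, withDensity_apply _ hBm, Measure.restrict_restrict hBm,
            Set.inter_eq_left.2 fun x hx => (hBc x hx).2]
      _ ≤ squareLaw f (gridCell N ⁻¹' {c}) := measure_mono fun x hx => (hBc x hx).1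
  have := ENNReal.toReal_mono (measure_ne_top _ _) hle
  rwa [ENNReal.toReal_ofReal (by positivity)] at this

lemma sum_squareLaw_gridCell (f : Plane → ℝ) [IsProbabilityMeasure (squareLaw f)] {N : ℤ}
    (hN : 1 ≤ N) : ∑ c ∈ gridBox N, (squareLaw f).real (gridCell N ⁻¹' {c}) = 1 := by
  rw [sum_measureReal_preimage_singleton _
    fun c _ => measurable_gridCell (measurableSet_singleton _)]
  have h : (squareLaw f) (gridCell N ⁻¹' (gridBox N : Set (ℤ × ℤ)))ᶜ = 0 := by
    refine measure_mono_null ?_ (squareLaw_compl_unitSquare f)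
    intro x hx hxs
    exact hx (gridCell_mem_gridBox hN hxs)
  have hm : MeasurableSet (gridCell N ⁻¹' (gridBox N : Set (ℤ × ℤ))) :=
    measurable_gridCell (gridBox N).measurableSet
  rw [Measure.real, (prob_compl_eq_zero_iff hm).1 h, ENNReal.toReal_one]

/-! ### Almost spanning cycles when `n r ^ 2 → ∞` -/

/-- The number of points that makes a cell populous enough, when cells interact up to distance
`M`. -/
def populous (M : ℤ) : ℕ := ((2 * M + 1) ^ 2).toNat + 3

lemma card_le_longestCycleLength_of_cellReach {n : ℕ} {r : ℝ} {M N : ℤ} (hM : 2 ≤ M) (hN : 1 ≤ N)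
    (hMr : (M : ℝ) ≤ N * r) {x : Fin n → Plane} (hx : ∀ i, x i ∈ unitSquare) {g : ℤ × ℤ}
    (hg : populous M ≤ cellCount (fun i => gridCell N (x i)) g) (A : Finset (Fin n))
    (hA : ∀ i ∈ A, CellReach (NearCell M)
      (fun c => populous M ≤ cellCount (fun i => gridCell N (x i)) c) g (gridCell N (x i))) :
    A.card ≤ longestCycleLength (geometricGraph r x) := by
  refine card_reachable_le_longestCycleLength (κ := fun i => gridCell N (x i)) (R := NearCell M)
    (fun _ _ => NearCell.symm) ?_ (card_le_of_nearCell (by omega)) hg A hA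
  intro u v huv h
  refine ⟨huv, dist_lt_of_nearCell (by omega) hN hMr (hx u) (hx v) ?_⟩
  rcases h with h | h
  · rw [h]
    exact nearCell_of_eq hM _
  · exact h

/-- With `3 ^ k` cells per side the grid is a single block of level `k`, so all its fine cells are
connected. -/
lemma mem_gridBox_three_pow {k : ℕ} {c : ℤ × ℤ} :
    c ∈ gridBox (3 ^ k) ↔ parentBlock^[k] c = (0, 0) := by
  have h3 : (0 : ℤ) < 3 ^ k := by positivity
  have key : ∀ z : ℤ, (0 ≤ z ∧ z < 3 ^ k) ↔ z / 3 ^ k = 0 := by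
    intro z
    constructor
    · rintro ⟨h1, h2⟩
      exact Int.ediv_eq_zero_of_lt h1 h2
    · intro h
      have e := Int.emod_add_mul_ediv z (3 ^ k)
      rw [h, mul_zero, add_zero] at e
      rw [← e]
      exact ⟨Int.emod_nonneg _ h3.ne', Int.emod_lt_of_pos _ h3⟩
  rw [mem_gridBox, iterate_parentBlock, key, key, Prod.mk.injEq]

/-- A point lies in a cell with a bad block around it only with small probability. -/
lemma weightSum_not_isFineCell_le {n k K : ℕ} {w : ℤ × ℤ → ℝ} (hw : ∀ c, 0 ≤ w c)
    (hw1 : ∑ c ∈ gridBox (3 ^ k), w c = 1) {p t q : ℝ} (ht : 0 ≤ t)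
    (hp : ∀ c ∈ gridBox (3 ^ k), p ≤ w c)
    (hq : q = Real.exp (t * K - (1 - Real.exp (-t)) * ((n - 1 : ℕ) * p))) (hq1 : 81 * q ≤ 1 / 2)
    (i : Fin n) : weightSum n w (gridBox (3 ^ k))
      (fun κ => ¬ IsFineCell (fun c => cellCount κ c < K) k (κ i)) ≤ 162 * q := by
  choose F hF1 hF2 hF3 using exists_family_of_isBadBlock
  have hq0 : 0 ≤ q := hq ▸ (Real.exp_pos _).le
  -- The blocks around point `i` depend on its own cell, which is therefore fixed to be `c`; this
  -- contributes the factor `w c`, and these factors sum to one.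
  have hone : ∀ c ∈ gridBox (3 ^ k), ∀ j ∈ Finset.range (k + 1), ∀ T ∈ F j (parentBlock^[j] c),
      weightSum n w (gridBox (3 ^ k)) (fun κ => κ i ∈ ({c} : Finset _) ∧
        ∀ u ∈ T, cellCount κ u < K) ≤ w c * q ^ 2 ^ j := by
    intro c hc j hj T hT
    obtain ⟨hT1, hT2⟩ := hF2 j _ T hT
    have hTbox : T ⊆ gridBox (3 ^ k) := by
      intro u hu
      have hjk : k - j + j = k := Nat.sub_add_cancel (by rw [Finset.mem_range] at hj; omega)
      rw [mem_gridBox_three_pow] at hc ⊢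
      rw [← hjk, Function.iterate_add_apply] at hc ⊢
      rw [hT2 u hu, hc]
    have := weightSum_sparse_le hw hw1 ht (Finset.singleton_subset_iff.2 hc) hTbox
      (fun u hu => hp u (hTbox hu)) K i
    rwa [Finset.sum_singleton, hT1, ← hq] at this
  have hlevel : ∀ c ∈ gridBox (3 ^ k), ∀ j ∈ Finset.range (k + 1),
      weightSum n w (gridBox (3 ^ k)) (fun κ => ∃ T ∈ F j (parentBlock^[j] c),
        κ i ∈ ({c} : Finset _) ∧ ∀ u ∈ T, cellCount κ u < K) ≤ w c * (81 * q * (1 / 2) ^ j) := by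
    intro c hc j hj
    refine (weightSum_exists_le hw _ _).trans ((Finset.sum_le_sum (hone c hc j hj)).trans ?_)
    rw [Finset.sum_const, nsmul_eq_mul, mul_left_comm]
    refine mul_le_mul_of_nonneg_left ?_ (hw c)
    calc ((F j (parentBlock^[j] c)).card : ℝ) * q ^ 2 ^ j ≤ 81 ^ 2 ^ j * q ^ 2 ^ j := by
          refine mul_le_mul_of_nonneg_right ?_ (by positivity)
          calc ((F j (parentBlock^[j] c)).card : ℝ) ≤ ((81 ^ (2 ^ j - 1) : ℕ) : ℝ) := by
                exact_mod_cast hF1 j _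
            _ ≤ 81 ^ 2 ^ j := by
                push_cast
                exact pow_le_pow_right₀ (by norm_num) (Nat.sub_le _ _)
      _ = (81 * q) ^ 2 ^ j := (mul_pow _ _ _).symm
      -- The doubly exponential decay is weakened to a geometric one, whose sum over the levels is
      -- at most `162 * q`.
      _ ≤ (81 * q) ^ (j + 1) :=
          pow_le_pow_of_le_one (by positivity) (by linarith) Nat.lt_two_pow_self
      _ = 81 * q * (81 * q) ^ j := pow_succ' _ _
      _ ≤ 81 * q * (1 / 2) ^ j := by gcongr
  have hcell : ∀ c ∈ gridBox (3 ^ k),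
      weightSum n w (gridBox (3 ^ k)) (fun κ => ∃ j ∈ Finset.range (k + 1),
        ∃ T ∈ F j (parentBlock^[j] c),
        κ i ∈ ({c} : Finset _) ∧ ∀ u ∈ T, cellCount κ u < K) ≤ w c * (162 * q) := by
    intro c hc
    refine (weightSum_exists_le hw _ _).trans ((Finset.sum_le_sum (hlevel c hc)).trans ?_)
    rw [← Finset.mul_sum, ← Finset.mul_sum]
    refine mul_le_mul_of_nonneg_left ?_ (hw c)
    have : ∑ j ∈ Finset.range (k + 1), ((1 : ℝ) / 2) ^ j ≤ 2 := sum_geometric_two_le _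
    nlinarith
  calc weightSum n w (gridBox (3 ^ k))
        (fun κ => ¬ IsFineCell (fun c => cellCount κ c < K) k (κ i))
    _ ≤ weightSum n w (gridBox (3 ^ k)) (fun κ => ∃ c ∈ gridBox (3 ^ k),
        ∃ j ∈ Finset.range (k + 1), ∃ T ∈ F j (parentBlock^[j] c),
        κ i ∈ ({c} : Finset _) ∧ ∀ u ∈ T, cellCount κ u < K) := by
        refine weightSum_mono hw ?_
        intro κ hκ hnf
        unfold IsFineCell at hnf
        push Not at hnf
        obtain ⟨j, hj, hbad⟩ := hnf
        obtain ⟨T, hT, hTS⟩ := hF3 j _ _ hbad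
        exact ⟨κ i, hκ i, j, Finset.mem_range.2 (by omega), T, hT, Finset.mem_singleton_self _, hTS⟩
    _ ≤ ∑ c ∈ gridBox (3 ^ k), w c * (162 * q) :=
        (weightSum_exists_le hw _ _).trans (Finset.sum_le_sum hcell)
    _ = 162 * q := by rw [← Finset.sum_mul, hw1, one_mul]

section Probability

variable {Ω : Type*} [MeasurableSpace Ω] {P : Measure Ω} [IsProbabilityMeasure P]
  {f : Plane → ℝ} {n : ℕ} {X : Fin n → Ω → Plane}

lemma isProbabilityMeasure_squareLaw (hlaw : ∀ i, HasLaw (X i) (squareLaw f) P) (hn : 1 ≤ n) :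
    IsProbabilityMeasure (squareLaw f) :=
  (hlaw ⟨0, hn⟩).isProbabilityMeasure_iff.1 inferInstance

/-- If cells are small compared to `r`, all but a small proportion of the points lie on a common
cycle. -/
lemma one_sub_le_prob_longestCycleLength {a : ℝ} (hfm : Measurable f) (ha : 0 ≤ a)
    (hfa : ∀ x ∈ unitSquare, a ≤ f x) (hind : iIndepFun X P)
    (hlaw : ∀ i, HasLaw (X i) (squareLaw f) P) (hn : 1 ≤ n) {r : ℝ} {k : ℕ}
    (hr : 3 ≤ 3 ^ k * r) {q θ : ℝ} (hθ : 0 < θ) (hθ1 : θ < 1)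
    (hq : q = Real.exp (populous 3 - (1 - Real.exp (-1)) * ((n - 1 : ℕ) * (a / (3 ^ k) ^ 2))))
    (hq1 : 81 * q ≤ 1 / 2) :
    1 - 162 * q / θ ≤ P.real {ω | (longestCycleLength (geometricGraph r fun i => X i ω) : ℝ) ≥
      n - n * θ} := by
  classical
  have := isProbabilityMeasure_squareLaw hlaw hn
  have hn0 : (0 : ℝ) < n := by exact_mod_cast hn
  have hN : (1 : ℤ) ≤ 3 ^ k := one_le_pow₀ (by norm_num)
  set w : ℤ × ℤ → ℝ := fun c => (squareLaw f).real (gridCell (3 ^ k) ⁻¹' {c}) with hwdef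
  have hw : ∀ c, 0 ≤ w c := fun c => measureReal_nonneg
  have hw1 : ∑ c ∈ gridBox (3 ^ k), w c = 1 := sum_squareLaw_gridCell f hN
  have hp : ∀ c ∈ gridBox (3 ^ k), a / (3 ^ k) ^ 2 ≤ w c := fun c hc => by
    have := le_squareLaw_gridCell hfm ha hfa hN hc
    push_cast at this
    exact this
  set Q : Fin n → (Fin n → ℤ × ℤ) → Prop :=
    fun i κ => ¬ IsFineCell (fun c => cellCount κ c < populous 3) k (κ i) with hQ
  have hbad : weightSum n w (gridBox (3 ^ k))
      (fun κ => n * θ < (Finset.univ.filter fun i => Q i κ).card) ≤ 162 * q / θ := by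
    have h1 := mul_weightSum_card_le (n := n) (box := gridBox (3 ^ k)) hw Q (n * θ)
    have h2 : ∑ i, weightSum n w (gridBox (3 ^ k)) (Q i) ≤ ∑ _i : Fin n, 162 * q :=
      Finset.sum_le_sum fun i _ => weightSum_not_isFineCell_le (t := 1) hw hw1 zero_le_one hp
        (by rw [hq, one_mul]) hq1 i
    rw [Finset.sum_const, Finset.card_univ, Fintype.card_fin, nsmul_eq_mul] at h2
    rw [le_div_iff₀ hθ]
    have h3 := h1.trans h2
    rw [mul_assoc] at h3
    have := le_of_mul_le_mul_left h3 hn0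
    rwa [mul_comm] at this
  refine le_trans (sub_le_sub_left hbad 1) ?_
  refine one_sub_weightSum_le hind hlaw measurableSet_unitSquare (squareLaw_compl_unitSquare f)
    (measurable_gridCell (N := 3 ^ k)) (fun x hx => gridCell_mem_gridBox hN hx) ?_
  intro ω hω hgood
  simp only [not_lt] at hgood
  set κ : Fin n → ℤ × ℤ := fun i => gridCell (3 ^ k) (X i ω) with hκ
  set A : Finset (Fin n) := Finset.univ.filter fun i => ¬ Q i κ with hA
  have hcard : (Finset.univ.filter fun i => Q i κ).card + A.card = n := by
    rw [hA, Finset.card_filter_add_card_filter_not, Finset.card_univ, Fintype.card_fin]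
  have hcard' : ((Finset.univ.filter fun i => Q i κ).card : ℝ) + A.card = n := by
    exact_mod_cast hcard
  -- Since `θ < 1`, some point lies in a fine cell; its cell is populous and serves as the start
  -- `g`.
  have hApos : 0 < A.card := by
    have : (0 : ℝ) < A.card := by nlinarith
    exact_mod_cast this
  obtain ⟨i₀, hi₀⟩ := Finset.card_pos.1 hApos
  have hfine : ∀ i ∈ A, IsFineCell (fun c => cellCount κ c < populous 3) k (κ i) := by
    intro i hi
    exact not_not.1 (Finset.mem_filter.1 hi).2
  have hle : A.card ≤ longestCycleLength (geometricGraph r fun i => X i ω) := by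
    refine card_le_longestCycleLength_of_cellReach (M := 3) (N := 3 ^ k) (by norm_num) hN
      (by push_cast; exact hr) hω (g := κ i₀) ?_ A ?_
    · have := hfine i₀ hi₀ 0 (Nat.zero_le _)
      exact not_lt.1 this
    · intro i hi
      have hbox : ∀ j, parentBlock^[k] (κ j) = (0, 0) := fun j =>
        mem_gridBox_three_pow.1 (gridCell_mem_gridBox hN (hω j))
      have := cellReach_of_isFineCell (R := NearCell 3) (fun u v => nearCell_of_natAbs_le le_rfl)
        ((hbox i₀).trans (hbox i).symm) (hfine i₀ hi₀) (hfine i hi)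
      simpa only [not_lt] using this
  have hle' : (A.card : ℝ) ≤ longestCycleLength (geometricGraph r fun i => X i ω) := by
    exact_mod_cast hle
  simp only [Set.mem_ofPred_eq, ge_iff_le]
  linarith

/-- If `r ≥ 2`, all points are on a common cycle almost surely. -/
lemma prob_longestCycleLength_of_two_le (hind : iIndepFun X P)
    (hlaw : ∀ i, HasLaw (X i) (squareLaw f) P) (hn : populous 2 ≤ n) {r : ℝ} (hr : 2 ≤ r) {y : ℝ}
    (hy : y ≤ n) :
    1 ≤ P.real {ω | (longestCycleLength (geometricGraph r fun i => X i ω) : ℝ) ≥ y} := by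
  have h0 : weightSum n (fun c => (squareLaw f).real (gridCell 1 ⁻¹' {c})) (gridBox 1)
      (fun _ => False) = 0 := by
    unfold weightSum
    simp
  refine le_of_eq_of_le ?_ (one_sub_weightSum_le (Bad := fun _ => False) hind hlaw
    measurableSet_unitSquare (squareLaw_compl_unitSquare f) (measurable_gridCell (N := 1))
    (fun x hx => gridCell_mem_gridBox le_rfl hx) ?_)
  · rw [h0, sub_zero]
  · intro ω hω _
    have hcell : ∀ i, gridCell 1 (X i ω) = (0, 0) := by
      intro i
      have := mem_gridBox.1 (gridCell_mem_gridBox le_rfl (hω i))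
      rw [Prod.ext_iff]
      simp only
      omega
    have hle := card_le_longestCycleLength_of_cellReach (M := 2) (N := 1) (r := r) le_rfl le_rfl
      (by push_cast; linarith) hω (g := (0, 0))
      (by simpa [cellCount, hcell] using hn) Finset.univ fun i _ => by rw [hcell i]; exact .refl
    rw [Finset.card_univ, Fintype.card_fin] at hle
    exact hy.trans (by exact_mod_cast hle)

end Probability

/-- The least `k` with `3 ≤ 3 ^ k * r` works, since one power less gives a product below 3; the
bound on `r` handles `k = 0`. -/
lemma exists_three_pow_mul {r : ℝ} (hr : 0 < r) (hr2 : r ≤ 2) :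
    ∃ k : ℕ, 3 ≤ 3 ^ k * r ∧ 3 ^ k * r ≤ 9 := by
  classical
  have hex : ∃ k : ℕ, 3 ≤ 3 ^ k * r := by
    obtain ⟨k, hk⟩ := pow_unbounded_of_one_lt (3 / r) (by norm_num : (1 : ℝ) < 3)
    exact ⟨k, ((div_lt_iff₀ hr).1 hk).le⟩
  refine ⟨Nat.find hex, Nat.find_spec hex, ?_⟩
  rcases hk : Nat.find hex with _ | k
  · simp only [pow_zero]; linarith
  · have := Nat.find_min hex (m := k) (by omega)
    push Not at this
    rw [pow_succ]
    linarith

/-- If `n r ^ 2 → ∞`, then with high probability a cycle misses only an exponentially small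
proportion of the points. -/
theorem exists_almost_spanning_cycle {Ω : Type*} [MeasurableSpace Ω] {P : Measure Ω}
    [IsProbabilityMeasure P] {f : Plane → ℝ} (hf : IsSquareDensity f)
    {X : (n : ℕ) → Fin n → Ω → Plane} (hXindep : ∀ n, iIndepFun (X n) P)
    (hXlaw : ∀ n i, HasLaw (X n i) (squareLaw f) P) {r : ℕ → ℝ} (hr : ∀ n, 0 < r n)
    (hA : Tendsto (fun n : ℕ => (n : ℝ) * r n ^ 2) atTop atTop) :
    ∃ δ > (0 : ℝ), ∀ᶠ n : ℕ in atTop,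
      P.real {ω | (longestCycleLength (geometricGraph (r n) (fun i => X n i ω)) : ℝ) ≥
          n - n * Real.exp (-δ * (n * r n ^ 2))} ≥ 1 - Real.exp (-δ * (n * r n ^ 2)) := by
  obtain ⟨a, ha, hfa⟩ := hf.bounded_below
  -- `324 = 81 * 2 * 2`: cells have side at least `r / 9`, and both `(n - 1) / n` and `1 - exp (-1)`
  -- are at least `1 / 2`.
  set β : ℝ := a / 324 with hβ
  have hβ0 : 0 < β := by positivity
  refine ⟨β / 4, by positivity, ?_⟩
  have hlim : Tendsto (fun n : ℕ => Real.exp (β / 2 * ((n : ℝ) * r n ^ 2))) atTop atTop :=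
    Real.tendsto_exp_atTop.comp (hA.const_mul_atTop (by positivity))
  filter_upwards [hlim.eventually_ge_atTop (162 * Real.exp (populous 3)),
    eventually_ge_atTop (populous 2), eventually_ge_atTop 2, hA.eventually_gt_atTop 0]
    with n h1 hn2 hn hA0
  set A : ℝ := (n : ℝ) * r n ^ 2 with hAdef
  have hn' : (2 : ℝ) ≤ n := by exact_mod_cast hn
  rcases le_total (2 : ℝ) (r n) with hr2 | hr2
  · refine le_trans ?_ (prob_longestCycleLength_of_two_le (hXindep n) (hXlaw n) hn2 hr2 ?_)
    · linarith [Real.exp_pos (-(β / 4) * A)]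
    · have : 0 ≤ (n : ℝ) * Real.exp (-(β / 4) * A) := by positivity
      linarith
  · obtain ⟨k, hk3, hk9⟩ := exists_three_pow_mul (hr n) hr2
    set q : ℝ := Real.exp (populous 3 - (1 - Real.exp (-1)) *
      ((n - 1 : ℕ) * (a / (3 ^ k) ^ 2))) with hq
    have hp : a * r n ^ 2 / 81 ≤ a / (3 ^ k) ^ 2 := by
      rw [div_le_div_iff₀ (by norm_num) (by positivity)]
      have : (3 ^ k * r n) ^ 2 ≤ 9 ^ 2 := pow_le_pow_left₀ (by linarith) hk9 2
      rw [mul_pow] at this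
      nlinarith
    have hcast : ((n - 1 : ℕ) : ℝ) = n - 1 := by
      rw [Nat.cast_sub (by omega), Nat.cast_one]
    have he : Real.exp (-1) ≤ 1 / 2 := by
      rw [Real.exp_neg, one_div]
      exact inv_anti₀ (by norm_num) (by linarith [Real.add_one_le_exp (1 : ℝ)])
    have hexp : β * A ≤ (1 - Real.exp (-1)) * ((n - 1 : ℕ) * (a / (3 ^ k) ^ 2)) := by
      have e1 : (n : ℝ) / 2 * (a * r n ^ 2 / 81) ≤ (n - 1 : ℕ) * (a / (3 ^ k) ^ 2) := by
        rw [hcast]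
        have : (0 : ℝ) ≤ a * r n ^ 2 / 81 := by positivity
        exact mul_le_mul (by linarith) hp this (by linarith)
      have e2 : 1 / 2 * ((n : ℝ) / 2 * (a * r n ^ 2 / 81)) ≤
          (1 - Real.exp (-1)) * ((n - 1 : ℕ) * (a / (3 ^ k) ^ 2)) :=
        mul_le_mul (by linarith) e1 (by positivity) (by linarith)
      refine le_trans (le_of_eq ?_) e2
      rw [hβ, hAdef]; ring
    have hqle : q ≤ Real.exp (populous 3) * Real.exp (-(β * A)) := by
      rw [hq, ← Real.exp_add]
      exact Real.exp_le_exp.2 (by linarith)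
    have hq162 : 162 * q ≤ Real.exp (-(β / 2 * A)) := by
      calc 162 * q ≤ 162 * Real.exp (populous 3) * Real.exp (-(β * A)) := by linarith
        _ ≤ Real.exp (β / 2 * A) * Real.exp (-(β * A)) := by gcongr
        _ = Real.exp (-(β / 2 * A)) := by rw [← Real.exp_add]; congr 1; ring
    have hlt : Real.exp (-(β / 4) * A) < 1 :=
      (Real.exp_lt_exp.2 (by nlinarith)).trans_eq Real.exp_zero
    have hle1 : Real.exp (-(β / 2 * A)) ≤ 1 := Real.exp_le_one_iff.2 (by
      have := mul_pos hβ0 hA0; linarith)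
    -- Half of the exponent `β / 2` pays for the proportion `θ = exp (-(β / 4) * A)` in Markov's
    -- inequality; the other half is the failure probability.
    refine le_trans ?_ (one_sub_le_prob_longestCycleLength hf.measurable ha.le hfa (hXindep n)
      (hXlaw n) (by omega) hk3 (Real.exp_pos (-(β / 4) * A)) hlt hq (by linarith))
    refine sub_le_sub_left ?_ 1
    rw [div_le_iff₀ (Real.exp_pos _), ← Real.exp_add]
    refine hq162.trans (Real.exp_le_exp.2 (by linarith))

/-! ### Hamiltonian cycles for the uniform density -/

/-- There is a set of offsets to the right which nearly fills a set of area `6 / 5` in a half disc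
of radius `1`, at the scale `1 / (5 * k + 1)`. -/
lemma exists_walkOffsets {k : ℤ} (hk : 1 ≤ k) : ∃ B : Finset (ℤ × ℤ),
    (∀ b ∈ B, 1 ≤ b.1 ∧ NearCell (5 * k + 1) b 0) ∧
    (B.card : ℤ) = (3 * k - 1) * (8 * k - 1) + k * (6 * k - 1) := by
  -- The two rectangles have their outer corners near `(3k, 4k)` and `(4k, 3k)`, on the circle of
  -- radius `5k`.
  refine ⟨Finset.Icc 1 (3 * k - 1) ×ˢ Finset.Icc (-(4 * k - 1)) (4 * k - 1) ∪
    Finset.Icc (3 * k) (4 * k - 1) ×ˢ Finset.Icc (-(3 * k - 1)) (3 * k - 1), ?_, ?_⟩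
  · intro b hb
    rw [Finset.mem_union, Finset.mem_product, Finset.mem_product, Finset.mem_Icc,
      Finset.mem_Icc, Finset.mem_Icc, Finset.mem_Icc] at hb
    have key : ∀ s t : ℤ, |b.1| ≤ s → |b.2| ≤ t → (s + 1) ^ 2 + (t + 1) ^ 2 < (5 * k + 1) ^ 2 →
        NearCell (5 * k + 1) b 0 := by
      intro s t hs ht h
      unfold NearCell
      simp only [Prod.fst_zero, Prod.snd_zero, sub_zero]
      refine lt_of_le_of_lt ?_ h
      gcongr
    rcases hb with ⟨h1, h2⟩ | ⟨h1, h2⟩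
    · exact ⟨h1.1, key (3 * k - 1) (4 * k - 1) (abs_le.2 (by omega)) (abs_le.2 (by omega))
        (by nlinarith)⟩
    · exact ⟨by omega, key (4 * k - 1) (3 * k - 1) (abs_le.2 (by omega)) (abs_le.2 (by omega))
        (by nlinarith)⟩
  · rw [Finset.card_union_of_disjoint]
    · rw [Finset.card_product, Finset.card_product, Int.card_Icc, Int.card_Icc, Int.card_Icc,
        Int.card_Icc]
      push_cast
      rw [Int.toNat_of_nonneg (by omega), Int.toNat_of_nonneg (by omega),
        Int.toNat_of_nonneg (by omega), Int.toNat_of_nonneg (by omega)]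
      ring
    · rw [Finset.disjoint_left]
      intro b hb hb'
      rw [Finset.mem_product, Finset.mem_Icc] at hb hb'
      omega

/-- The cells of the `L × L` window at `o`. -/
noncomputable def windowCells (L : ℤ) (o : ℤ × ℤ) : Finset (ℤ × ℤ) :=
  Finset.Ico o.1 (o.1 + L) ×ˢ Finset.Ico o.2 (o.2 + L)

/-- The cells of the four `L × L` windows at the corners of the grid. -/
noncomputable def cornerCells (N L : ℤ) : Finset (ℤ × ℤ) :=
  (Finset.Ico 0 L ∪ Finset.Ico (N - L) N) ×ˢ (Finset.Ico 0 L ∪ Finset.Ico (N - L) N)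

lemma card_windowCells (L : ℤ) (o : ℤ × ℤ) : (windowCells L o).card = L.toNat ^ 2 := by
  rw [windowCells, Finset.card_product, Int.card_Ico, Int.card_Ico, add_sub_cancel_left,
    add_sub_cancel_left, sq]

lemma card_cornerCells_le (N L : ℤ) : (cornerCells N L).card ≤ (2 * L.toNat) ^ 2 := by
  have : (Finset.Ico 0 L ∪ Finset.Ico (N - L) N).card ≤ 2 * L.toNat := by
    refine (Finset.card_union_le _ _).trans ?_
    rw [Int.card_Ico, Int.card_Ico, sub_zero, sub_sub_cancel, two_mul]
  rw [cornerCells, Finset.card_product, sq]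
  exact Nat.mul_le_mul this this

section Probability

variable {Ω : Type*} [MeasurableSpace Ω] {P : Measure Ω} [IsProbabilityMeasure P]
  {f : Plane → ℝ} {n : ℕ} {X : Fin n → Ω → Plane}

/-- A union bound: `N ^ 2` windows with at most `2 ^ (L ^ 2)` choices of `m` sparse cells each, and
at most `(2 * L) ^ 2` corner cells. If none of these events occurs, every cell is reachable and the
cycle contains all points. -/
lemma one_sub_le_prob_longestCycleLength_eq {a : ℝ} (hfm : Measurable f) (ha : 0 ≤ a)
    (hfa : ∀ x ∈ unitSquare, a ≤ f x) (hind : iIndepFun X P)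
    (hlaw : ∀ i, HasLaw (X i) (squareLaw f) P) (hn : 1 ≤ n) {r : ℝ} {M N L : ℤ} {m : ℕ}
    (hM : 3 ≤ M) {B : Finset (ℤ × ℤ)} (hB : ∀ b ∈ B, 1 ≤ b.1 ∧ NearCell M b 0)
    (hBm : B.card = m) (hm : 1 ≤ m) (hL : L = 2 * (M * m + M) + 1) (hN : 2 * L ≤ N)
    (hMr : (M : ℝ) ≤ N * r) {q t : ℝ} (ht : 0 ≤ t)
    (hq : q = Real.exp (t * populous M -
      (1 - Real.exp (-t)) * ((n - 1 : ℕ) * (a / (N : ℝ) ^ 2)))) :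
    1 - ((N : ℝ) ^ 2 * (2 ^ L.toNat ^ 2 * q ^ m) + (2 * L.toNat : ℝ) ^ 2 * q) ≤
      P.real {ω | longestCycleLength (geometricGraph r fun i => X i ω) = n} := by
  classical
  have := isProbabilityMeasure_squareLaw hlaw hn
  have hL0 : 0 < L := by
    have : 0 ≤ M * m := by positivity
    omega
  have hN1 : 1 ≤ N := by omega
  set K := populous M with hK
  set w : ℤ × ℤ → ℝ := fun c => (squareLaw f).real (gridCell N ⁻¹' {c}) with hwdef
  have hw : ∀ c, 0 ≤ w c := fun c => measureReal_nonneg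
  have hw1 : ∑ c ∈ gridBox N, w c = 1 := sum_squareLaw_gridCell f hN1
  have hp : ∀ c ∈ gridBox N, a / (N : ℝ) ^ 2 ≤ w c := fun c hc =>
    le_squareLaw_gridCell hfm ha hfa hN1 hc
  have hq0 : 0 ≤ q := hq ▸ (Real.exp_pos _).le
  set i₀ : Fin n := ⟨0, hn⟩ with hi₀
  -- No point needs to be singled out here; the condition on `i₀` always holds and merely fits the
  -- Chernoff bound, with total weight one.
  have hsparse : ∀ T ⊆ gridBox N, weightSum n w (gridBox N)
      (fun κ => κ i₀ ∈ gridBox N ∧ ∀ c ∈ T, cellCount κ c < K) ≤ q ^ T.card := by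
    intro T hT
    have := weightSum_sparse_le hw hw1 ht (Finset.Subset.refl (gridBox N)) hT
      (fun c hc => hp c (hT hc)) K i₀
    rwa [hw1, one_mul, ← hq] at this
  set Bad : (Fin n → ℤ × ℤ) → Prop := fun κ =>
    (∃ o ∈ gridBox N, ∃ T ∈ (windowCells L o ∩ gridBox N).powersetCard m,
      κ i₀ ∈ gridBox N ∧ ∀ c ∈ T, cellCount κ c < K) ∨
    (∃ u ∈ cornerCells N L, κ i₀ ∈ gridBox N ∧ ∀ c ∈ ({u} : Finset (ℤ × ℤ)), cellCount κ c < K)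
    with hBad
  have hbad : weightSum n w (gridBox N) Bad ≤
      (N : ℝ) ^ 2 * (2 ^ L.toNat ^ 2 * q ^ m) + (2 * L.toNat : ℝ) ^ 2 * q := by
    refine (weightSum_or_le hw _ _).trans (add_le_add ?_ ?_)
    · have hwin : ∀ o ∈ gridBox N, weightSum n w (gridBox N) (fun κ =>
          ∃ T ∈ (windowCells L o ∩ gridBox N).powersetCard m,
            κ i₀ ∈ gridBox N ∧ ∀ c ∈ T, cellCount κ c < K) ≤ 2 ^ L.toNat ^ 2 * q ^ m := by
        intro o _
        refine (weightSum_exists_le hw _ _).trans ?_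
        calc _ ≤ ∑ _T ∈ (windowCells L o ∩ gridBox N).powersetCard m, q ^ m := by
              refine Finset.sum_le_sum fun T hT => ?_
              rw [Finset.mem_powersetCard] at hT
              rw [← hT.2]
              exact hsparse T (hT.1.trans Finset.inter_subset_right)
          _ = ((windowCells L o ∩ gridBox N).powersetCard m).card * q ^ m := by
              rw [Finset.sum_const, nsmul_eq_mul]
          _ ≤ 2 ^ L.toNat ^ 2 * q ^ m := by
              refine mul_le_mul_of_nonneg_right ?_ (by positivity)
              have h1 : ((windowCells L o ∩ gridBox N).powersetCard m).card ≤
                  2 ^ L.toNat ^ 2 := by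
                rw [Finset.card_powersetCard, ← card_windowCells L o]
                exact (Nat.choose_le_two_pow _ _).trans (Nat.pow_le_pow_right (by norm_num)
                  (Finset.card_le_card Finset.inter_subset_left))
              exact_mod_cast h1
      refine (weightSum_exists_le hw _ _).trans ((Finset.sum_le_sum hwin).trans_eq ?_)
      rw [Finset.sum_const, nsmul_eq_mul, gridBox, Finset.card_product, Int.card_Ico, sub_zero]
      have : ((N.toNat : ℕ) : ℝ) = N := by exact_mod_cast Int.toNat_of_nonneg (by omega : 0 ≤ N)
      rw [Nat.cast_mul, this, ← sq]
    · refine (weightSum_exists_le hw _ _).trans ?_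
      calc _ ≤ ∑ _u ∈ cornerCells N L, q := by
            refine Finset.sum_le_sum fun u hu => ?_
            have hubox : ({u} : Finset (ℤ × ℤ)) ⊆ gridBox N := by
              rw [Finset.singleton_subset_iff, mem_gridBox]
              simp only [cornerCells, Finset.mem_product, Finset.mem_union, Finset.mem_Ico] at hu
              omega
            have := hsparse _ hubox
            rwa [Finset.card_singleton, pow_one] at this
        _ = (cornerCells N L).card * q := by rw [Finset.sum_const, nsmul_eq_mul]
        _ ≤ (2 * L.toNat : ℝ) ^ 2 * q := by
            refine mul_le_mul_of_nonneg_right ?_ hq0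
            exact_mod_cast card_cornerCells_le N L
  refine le_trans (sub_le_sub_left hbad 1) ?_
  refine one_sub_weightSum_le hind hlaw measurableSet_unitSquare (squareLaw_compl_unitSquare f)
    (measurable_gridCell (N := N)) (fun x hx => gridCell_mem_gridBox hN1 hx) ?_
  intro ω hω hgood
  set κ : Fin n → ℤ × ℤ := fun i => gridCell N (X i ω) with hκ
  have hκbox : ∀ i, κ i ∈ gridBox N := fun i => gridCell_mem_gridBox hN1 (hω i)
  simp only [hBad, not_or] at hgood
  obtain ⟨hg1, hg2⟩ := hgood
  obtain ⟨g, hg, hreach⟩ := exists_cellReach_of_fewExceptions (D := fun c => K ≤ cellCount κ c)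
    hM hB hBm hm hL hN (by
      intro o h1 h2 h3 h4 T hT
      by_contra! hcard
      obtain ⟨T', hT', hT'm⟩ := Finset.exists_subset_card_eq hcard
      refine hg1 ⟨o, mem_gridBox.2 (by omega), T', Finset.mem_powersetCard.2 ⟨?_, hT'm⟩,
        hκbox i₀, fun c hc => not_le.1 (hT c (hT' hc)).2⟩
      intro u hu
      obtain ⟨hu1, hu2, hu3, hu4⟩ := (hT u (hT' hu)).1
      rw [Finset.mem_inter, windowCells, Finset.mem_product, Finset.mem_Ico, Finset.mem_Ico,
        mem_gridBox]
      omega) (by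
      intro u hu1 hu2
      by_contra hlt
      refine hg2 ⟨u, ?_, hκbox i₀, fun c hc => ?_⟩
      · simp only [cornerCells, Finset.mem_product, Finset.mem_union, Finset.mem_Ico]
        exact ⟨hu1, hu2⟩
      · rw [Finset.mem_singleton.1 hc]
        exact not_le.1 hlt)
  have hle := card_le_longestCycleLength_of_cellReach (by omega) hN1 hMr hω hg Finset.univ
    fun i _ => by
      obtain ⟨⟨h1, h2⟩, h3, h4⟩ := mem_gridBox.1 (hκbox i)
      exact hreach _ h1 h2 h3 h4
  have hge := longestCycleLength_le_card (G := geometricGraph r fun i => X i ω)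
  rw [Finset.card_univ, Fintype.card_fin] at hle
  rw [Fintype.card_fin] at hge
  exact le_antisymm hge hle

end Probability

lemma exp_neg_three_le : Real.exp (-3) ≤ 1 / 20 := by
  have h1 := Real.exp_one_gt_d9
  have h3 : Real.exp 3 = Real.exp 1 ^ 3 := by rw [← Real.exp_nat_mul]; norm_num
  have h2 : (2.718 : ℝ) ^ 3 ≤ Real.exp 1 ^ 3 := pow_le_pow_left₀ (by norm_num) (by linarith) 3
  rw [Real.exp_neg, one_div]
  refine inv_anti₀ (by norm_num) ?_
  rw [h3]
  refine le_trans (by norm_num) h2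

set_option maxHeartbeats 800000 in
/-- For the uniform density and `n r ^ 2` slightly above `log n`, there is a Hamiltonian cycle with
high probability. -/
theorem exists_spanning_cycle {Ω : Type*} [MeasurableSpace Ω] {P : Measure Ω}
    [IsProbabilityMeasure P] {f : Plane → ℝ} (hf : IsSquareDensity f)
    (hf1 : ∀ x ∈ unitSquare, f x = 1)
    {X : (n : ℕ) → Fin n → Ω → Plane} (hXindep : ∀ n, iIndepFun (X n) P)
    (hXlaw : ∀ n i, HasLaw (X n i) (squareLaw f) P) {r : ℕ → ℝ} (hr : ∀ n, 0 < r n) {w : ℕ → ℝ}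
    (hrw : ∀ᶠ n : ℕ in atTop,
      (n : ℝ) * r n ^ 2 = Real.log n + 7 * Real.log (Real.log n) + w n)
    (hw : Tendsto w atTop atTop)
    (hw' : Tendsto (fun n : ℕ => w n / Real.log (Real.log n)) atTop (𝓝 0)) :
    ∃ C > (0 : ℝ), ∀ᶠ n : ℕ in atTop,
      P.real {ω | longestCycleLength (geometricGraph (r n) (fun i => X n i ω)) = n} ≥
        1 - C * Real.exp (-w n) := by
  -- `k = 20` gives `M = 101` and `m = 11761`. The ratio `m / 102 ^ 2`, about `1.13`, exceeds 1 by
  -- enough to absorb the losses below.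
  obtain ⟨B, hB, hBcard⟩ := exists_walkOffsets (k := 20) (by norm_num)
  norm_num only at hB hBcard
  obtain ⟨m, hm⟩ : ∃ m : ℕ, B.card = m := ⟨_, rfl⟩
  rw [hm] at hBcard
  have hmr : (m : ℝ) = 11761 := by exact_mod_cast hBcard
  obtain ⟨L, hL⟩ : ∃ L : ℤ, L = 2 * (101 * m + 101) + 1 := ⟨_, rfl⟩
  have hL101 : (101 : ℝ) ≤ L := by exact_mod_cast (by omega : (101 : ℤ) ≤ L)
  obtain ⟨K, hK⟩ : ∃ K : ℝ, K = populous 101 := ⟨_, rfl⟩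
  -- `0.9405 = 0.95 * 0.99` accounts for `1 - exp (-3)` and `(n - 1) / n`, and `10404 = 102 ^ 2`
  -- bounds `(N * r) ^ 2`. What matters is `m * γ ≥ 1.05 > 1`.
  set γ : ℝ := 0.9405 / 10404 with hγ
  have hγ0 : 0 < γ := by norm_num [hγ]
  obtain ⟨W, hW⟩ : ∃ W : ℝ, W = 2 ^ L.toNat ^ 2 := ⟨_, rfl⟩
  have hW0 : 0 < W := hW ▸ by positivity
  obtain ⟨W', hW'⟩ : ∃ W' : ℝ, W' = (2 * L.toNat : ℝ) ^ 2 := ⟨_, rfl⟩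
  have hW'0 : 0 ≤ W' := hW' ▸ by positivity
  obtain ⟨C₁, hC₁⟩ : ∃ C₁, C₁ = 10404 * (W * Real.exp (3 * K) ^ m) := ⟨_, rfl⟩
  obtain ⟨C₂, hC₂⟩ : ∃ C₂, C₂ = W' * Real.exp (3 * K) := ⟨_, rfl⟩
  have hC₁0 : 0 < C₁ := hC₁ ▸ by positivity
  have hC₂0 : 0 ≤ C₂ := hC₂ ▸ by positivity
  have hlog : Tendsto (fun n : ℕ => Real.log n) atTop atTop :=
    Real.tendsto_log_atTop.comp tendsto_natCast_atTop_atTop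
  have hloglog : Tendsto (fun n : ℕ => Real.log (Real.log n)) atTop atTop :=
    Real.tendsto_log_atTop.comp hlog
  -- Chosen so that `r ^ 2 ≤ ε` gives `N ≥ 101 / r ≥ 2 * L`, leaving room for the windows.
  set ε : ℝ := (101 / (2 * L)) ^ 2 with hε
  have hε0 : 0 < ε := by positivity
  have hlittle : ∀ c > (0 : ℝ), ∀ᶠ x : ℝ in atTop, Real.log x ≤ c * x := by
    intro c hc
    filter_upwards [Real.isLittleO_log_id_atTop.bound hc, eventually_ge_atTop 1] with x hx hx1
    rw [Real.norm_of_nonneg (Real.log_nonneg hx1), id_eq,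
      Real.norm_of_nonneg (by linarith)] at hx
    exact hx
  refine ⟨C₁ + C₂, by linarith, ?_⟩
  filter_upwards [hrw, hw.eventually_ge_atTop 0, hw'.eventually_le_const (zero_lt_one),
    hloglog.eventually_ge_atTop 1, hlog.eventually_ge_atTop 1,
    hlog.eventually (hlittle γ hγ0), hlog.eventually (hlittle 1 one_pos),
    tendsto_natCast_atTop_atTop.eventually (hlittle (ε / 9) (by positivity)),
    eventually_ge_atTop 100] with n hA hw0 hwle hll hl hllγ hll1 hlε hn
  have hn100 : (100 : ℝ) ≤ n := by exact_mod_cast hn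
  have hn0 : (0 : ℝ) < n := by linarith
  rw [div_le_one (by linarith)] at hwle
  have hAlog : Real.log n ≤ n * r n ^ 2 := by rw [hA]; linarith
  have hAup : n * r n ^ 2 ≤ ε * n := by
    -- `9 = 1 + 7 + 1`, since `w n ≤ log log n ≤ log n`.
    calc n * r n ^ 2 ≤ 9 * Real.log n := by rw [hA]; linarith
      _ ≤ ε * n := by linarith
  have hrn := hr n
  have hrε : r n ≤ 101 / (2 * L) := by
    have : r n ^ 2 ≤ ε := by
      rw [mul_comm] at hAup
      exact le_of_mul_le_mul_right hAup hn0
    exact le_of_sq_le_sq this (by positivity)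
  have hr1 : r n ≤ 1 := hrε.trans (by rw [div_le_one (by linarith)]; linarith)
  obtain ⟨N, hNdef⟩ : ∃ N : ℤ, N = ⌈101 / r n⌉ := ⟨_, rfl⟩
  have hNlow : 101 / r n ≤ N := hNdef ▸ Int.le_ceil _
  have hNup : (N : ℝ) < 101 / r n + 1 := hNdef ▸ Int.ceil_lt_add_one _
  have hN2L : 2 * L ≤ N := by
    have : (2 * L : ℝ) ≤ 101 / r n := by
      rw [le_div_iff₀ (by linarith)] at hrε
      rw [le_div_iff₀ hrn]
      linarith
    exact_mod_cast this.trans hNlow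
  have hMr : ((101 : ℤ) : ℝ) ≤ N * r n := by
    push_cast
    exact (div_le_iff₀ hrn).1 hNlow
  have hN0 : (0 : ℝ) < N := lt_of_lt_of_le (by positivity) hNlow
  have hNr : N * r n ≤ 102 := by
    have := mul_lt_mul_of_pos_right hNup hrn
    rw [add_mul, div_mul_cancel₀ _ hrn.ne'] at this
    linarith
  have hNr2 : (N : ℝ) ^ 2 * r n ^ 2 ≤ 10404 := by
    have := pow_le_pow_left₀ (by positivity) hNr 2
    rw [mul_pow] at this
    linarith
  obtain ⟨q, hq⟩ : ∃ q, q = Real.exp (3 * (populous 101 : ℝ) -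
      (1 - Real.exp (-3)) * ((n - 1 : ℕ) * (1 / (N : ℝ) ^ 2))) := ⟨_, rfl⟩
  have hmain := one_sub_le_prob_longestCycleLength_eq (M := 101) hf.measurable zero_le_one
    (fun x hx => (hf1 x hx).ge) (hXindep n) (hXlaw n) (by omega) (by norm_num)
    hB hm (by omega) hL hN2L hMr (by norm_num) hq
  rw [← hW, ← hW'] at hmain
  refine le_trans (sub_le_sub_left ?_ 1) hmain
  have hexp : γ * (n * r n ^ 2) ≤ (1 - Real.exp (-3)) * ((n - 1 : ℕ) * (1 / (N : ℝ) ^ 2)) := by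
    have e1 : r n ^ 2 / 10404 ≤ 1 / (N : ℝ) ^ 2 := by
      rw [div_le_div_iff₀ (by norm_num) (by positivity)]
      linarith
    have e2 : 0.99 * (n : ℝ) ≤ (n - 1 : ℕ) := by
      rw [Nat.cast_sub (by omega), Nat.cast_one]
      linarith
    have e3 : 0.99 * (n : ℝ) * (r n ^ 2 / 10404) ≤ (n - 1 : ℕ) * (1 / (N : ℝ) ^ 2) :=
      mul_le_mul e2 e1 (by positivity) (by positivity)
    have e4 : 0.95 * (0.99 * (n : ℝ) * (r n ^ 2 / 10404)) ≤
        (1 - Real.exp (-3)) * ((n - 1 : ℕ) * (1 / (N : ℝ) ^ 2)) :=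
      mul_le_mul (by linarith [exp_neg_three_le]) e3 (by positivity)
        (by linarith [exp_neg_three_le])
    refine le_trans (le_of_eq ?_) e4
    rw [hγ]; ring
  rw [← hK] at hq
  have hq0 : 0 ≤ q := hq ▸ (Real.exp_pos _).le
  have hqle : q ≤ Real.exp (3 * K) * Real.exp (-(γ * Real.log n)) := by
    rw [hq, ← Real.exp_add]
    refine Real.exp_le_exp.2 ?_
    have := mul_le_mul_of_nonneg_left hAlog hγ0.le
    linarith
  have hqm : q ^ m ≤ Real.exp (3 * K) ^ m * Real.exp (-(1.05 * Real.log n)) := by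
    refine (pow_le_pow_left₀ hq0 hqle m).trans ?_
    rw [mul_pow]
    refine mul_le_mul_of_nonneg_left ?_ (by positivity)
    rw [← Real.exp_nat_mul, hmr]
    refine Real.exp_le_exp.2 ?_
    have h1 : (1.05 : ℝ) ≤ 11761 * γ := by norm_num [hγ]
    have h2 := mul_le_mul_of_nonneg_right h1 (zero_le_one.trans hl)
    linarith
  have hN2 : (N : ℝ) ^ 2 ≤ 10404 * n := by
    have h1 : (N : ℝ) ^ 2 * 1 ≤ (N : ℝ) ^ 2 * (n * r n ^ 2) :=
      mul_le_mul_of_nonneg_left (hl.trans hAlog) (by positivity)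
    have h2 := mul_le_mul_of_nonneg_left hNr2 hn0.le
    linarith
  have hnexp : (n : ℝ) = Real.exp (Real.log n) := (Real.exp_log hn0).symm
  -- Here `w n ≤ log log n ≤ γ * log n`, so a fixed negative power of `n` is below `exp (-w n)`.
  have hE : Real.exp (-(γ * Real.log n)) ≤ Real.exp (-w n) :=
    Real.exp_le_exp.2 (by linarith)
  have hE2 : n * Real.exp (-(1.05 * Real.log n)) ≤ Real.exp (-(γ * Real.log n)) := by
    nth_rewrite 1 [hnexp]
    rw [← Real.exp_add]
    refine Real.exp_le_exp.2 ?_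
    have h1 : γ ≤ 0.05 := by norm_num [hγ]
    have h2 := mul_le_mul_of_nonneg_right h1 (zero_le_one.trans hl)
    linarith
  have t1 : (N : ℝ) ^ 2 * (W * q ^ m) ≤ C₁ * Real.exp (-w n) := by
    calc (N : ℝ) ^ 2 * (W * q ^ m)
        ≤ (10404 * n) * (W *
          (Real.exp (3 * K) ^ m * Real.exp (-(1.05 * Real.log n)))) := by gcongr
      _ = C₁ * (n * Real.exp (-(1.05 * Real.log n))) := by rw [hC₁]; ring
      _ ≤ C₁ * Real.exp (-w n) := mul_le_mul_of_nonneg_left (hE2.trans hE) hC₁0.le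
  have t2 : W' * q ≤ C₂ * Real.exp (-w n) := by
    calc W' * q
        ≤ W' * (Real.exp (3 * K) * Real.exp (-(γ * Real.log n))) := by gcongr
      _ = C₂ * Real.exp (-(γ * Real.log n)) := by rw [hC₂]; ring
      _ ≤ C₂ * Real.exp (-w n) := mul_le_mul_of_nonneg_left hE hC₂0
  linarith

theorem theorem2 {Ω : Type*} [MeasurableSpace Ω] (P : Measure Ω) [IsProbabilityMeasure P]
    (f : Plane → ℝ) (hf : IsSquareDensity f)
    (X : (n : ℕ) → Fin n → Ω → Plane)
    (hXindep : ∀ n, iIndepFun (X n) P)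
    (hXlaw : ∀ n i, HasLaw (X n i) (squareLaw f) P)
    (r : ℕ → ℝ) (hr : ∀ n, 0 < r n) :
    (Tendsto (fun n : ℕ => (n : ℝ) * r n ^ 2) atTop atTop →
      ∃ δ₁ > (0 : ℝ), ∃ δ₂ > (0 : ℝ), ∀ᶠ n : ℕ in atTop,
        P.real {ω | (longestCycleLength (geometricGraph (r n) (fun i => X n i ω)) : ℝ) ≥
            n - n * Real.exp (-δ₁ * (n * r n ^ 2))} ≥
          1 - Real.exp (-δ₂ * (n * r n ^ 2))) ∧
    (∀ w : ℕ → ℝ,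
      (∀ x ∈ unitSquare, f x = 1) →
      (∀ᶠ n : ℕ in atTop,
        (n : ℝ) * r n ^ 2 = Real.log n + 7 * Real.log (Real.log n) + w n) →
      Tendsto w atTop atTop →
      Tendsto (fun n : ℕ => w n / Real.log (Real.log n)) atTop (𝓝 0) →
      ∃ C > (0 : ℝ), ∀ᶠ n : ℕ in atTop,
        P.real {ω | longestCycleLength (geometricGraph (r n) (fun i => X n i ω)) = n} ≥
          1 - C * Real.exp (-w n)) := by
  constructor
  · intro hA
    obtain ⟨δ, hδ, h⟩ := exists_almost_spanning_cycle hf hXindep hXlaw hr hA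
    exact ⟨δ, hδ, δ, hδ, h⟩
  · intro w hf1 hrw hw hw'
    exact exists_spanning_cycle hf hf1 hXindep hXlaw hr hrw hw hw'
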